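/- **Setting.** Let $M$ be a smooth 4-manifold, $\pi\colon E=\Sigma\times_M C(LM)\to M$ the bundle of pairs (Lorentzian metric of signature $(-+++)$, linear connection, possibly with torsion), with coordinates $(x^\mu,g_{\alpha\beta},\Gamma^\alpha_{\beta\gamma})$ induced by charts of $M$, and $J^1\pi$ its first jet bundle, with coordinates $(x^\mu,g_{\alpha\beta},\Gamma^\alpha_{\beta\gamma},g_{\alpha\beta,\mu},\Gamma^\alpha_{\beta\gamma,\mu})$; $\pi^1\colon J^1\pi\to E$ and $\bar\pi^1\colon J^1\pi\to M$ are the projections. For a function $f$ on $E$, $D_\mu f$ is the total derivative, a function on $J^1\pi$. The Einstein–Palatini Lagrangian density is $L\,d^4x$ with $L=\varrho\, g^{\alpha\beta}R_{\alpha\beta}$, where $\varrho=\sqrt{|\det g|}$ and $R_{\alpha\beta}=\Gamma^\gamma_{\beta\alpha,\gamma}-\Gamma^\gamma_{\gamma\alpha,\beta}+\Gamma^\gamma_{\beta\alpha}\Gamma^\sigma_{\sigma\gamma}-\Gamma^\gamma_{\beta\sigma}\Gamma^\sigma_{\gamma\alpha}$. Put $L^{\beta\gamma,\mu}_\alpha=\partial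 L/\partial\Gamma^\alpha_{\beta\gamma,\mu}$, $H=L^{\beta\gamma,\mu}_\alpha\Gamma^\alpha_{\beta\gamma,\mu}-L$, and let $\Omega=-d\Theta$ be the Poincaré–Cartan 5-form, $\Theta=L^{\beta\gamma,\mu}_\alpha\,d\Gamma^\alpha_{\beta\gamma}\wedge d^3x_\mu-H\,d^4x$ with $d^3x_\mu=i(\partial/\partial x^\mu)d^4x$. With $T^\alpha_{\beta\gamma}=\Gamma^\alpha_{\beta\gamma}-\Gamma^\alpha_{\gamma\beta}$ and $T^\alpha_{\beta\gamma,\nu}=\Gamma^\alpha_{\beta\gamma,\nu}-\Gamma^\alpha_{\gamma\beta,\nu}$, the final constraint submanifold $j_f\colon S_f\hookrightarrow J^1\pi$ is defined by the vanishing of - $c^{\mu\nu}=\dfrac{\partial H}{\partial g_{\mu\nu}}-\dfrac{\partial L^{\beta\gamma,\sigma}_\alpha}{\partial g_{\mu\nu}}\Gamma^\alpha_{\beta\gamma,\sigma}$, - $m_{\rho\sigma,\mu}=g_{\rho\sigma,\mu}-g_{\sigma\lambda}\Gamma^\lambda_{\mu\rho}-g_{\rho\lambda}\Gamma^\lambda_{\mu\sigma}-\tfrac23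 g_{\rho\sigma}T^\lambda_{\lambda\mu}$, - $t^\alpha_{\beta\gamma}=T^\alpha_{\beta\gamma}-\tfrac13\delta^\alpha_\beta T^\mu_{\mu\gamma}+\tfrac13\delta^\alpha_\gamma T^\mu_{\mu\beta}$, - $r^\alpha_{\beta\gamma,\nu}=T^\alpha_{\beta\gamma,\nu}-\tfrac13\delta^\alpha_\beta T^\mu_{\mu\gamma,\nu}+\tfrac13\delta^\alpha_\gamma T^\mu_{\mu\beta,\nu}$, - $i_{\rho\sigma,\mu\nu}=I_{\rho\sigma,\mu\nu}-I_{\rho\sigma,\nu\mu}$, where $I_{\rho\sigma,\mu\nu}=g_{\rho\kappa}\Gamma^\kappa_{\nu\lambda}\Gamma^\lambda_{\mu\sigma}+g_{\sigma\kappa}\Gamma^\kappa_{\nu\lambda}\Gamma^\lambda_{\mu\rho}+g_{\rho\lambda}\Gamma^\lambda_{\mu\sigma,\nu}+g_{\sigma\lambda}\Gamma^\lambda_{\mu\rho,\nu}+\tfrac23 g_{\rho\sigma}T^\lambda_{\lambda\mu,\nu}$. A vector is *tangent* to $S_f$ at a point of $S_f$ if the differentials of all these constraints annihilate it. A *natural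 gauge vector field* is a smooth vector field $X$ on $J^1\pi$ that is tangent to $S_f$, satisfies $j_f^*\,i(X)\Omega=0$, is $\bar\pi^1$-vertical, and is natural, that is, $X=j^1Y$ is the canonical lift of a smooth vector field $Y$ on $E$. **Proposition.** The natural gauge vector fields of the Einstein–Palatini system are, on $S_f$, exactly the vector fields with local expressions $$X=C_\beta\,\delta^\alpha_\gamma\frac{\partial}{\partial\Gamma^\alpha_{\beta\gamma}}+D_\mu C_\beta\,\delta^\alpha_\gamma\frac{\partial}{\partial\Gamma^\alpha_{\beta\gamma,\mu}},\qquad(\ast)$$ where the $C_\beta$ are smooth functions on $E$, the components of a horizontal 1-form $C_\beta\,dx^\beta$ on $E$. That is: 1. for every natural gauge vector field $X$ there is a smooth horizontal 1-form $C_\beta\,dx^\beta$ on $E$ such that $(\ast)$ holds at all points of $S_f$, in every chart; 2. for every smooth horizontal 1-form $C_\beta\,dx^\beta$ on $E$ there is a natural gauge vector field given by $(\ast)$ on the whole of $J^1\pi$, in every chart. Moreover, only the trace transformations are gauge. At every point of $S_f$, a $\bar\pi^1$-vertical vector $u$ with components $h_{\rho\sigma}$ along $\partial/\partial g_{\rho\sigma}$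 and $f^\alpha_{\beta\gamma}$ along $\partial/\partial\Gamma^\alpha_{\beta\gamma}$ satisfies $j_f^*\,i(u)\Omega=0$ if and only if $h=0$ and $f^\alpha_{\beta\gamma}=C_\beta\delta^\alpha_\gamma+K^\alpha_{\beta\gamma}$ for some numbers $C_\beta$ (trace solution) and some $K$ with $K^\alpha_{\beta\gamma}=-K^\alpha_{\gamma\beta}$, $K^\nu_{\nu\gamma}=0$ (torsion solution). If $K\neq0$, such a vector is not tangent to $S_f$, whatever its other components are. -/

import Mathlib

open scoped ContDiff Manifold

namespace EinsteinPalatini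

noncomputable section

/-! ### Coordinates on the configuration bundle and on its first jet bundle -/

/-- The model space of the space-time `M`: coordinates `x^μ`. -/
abbrev Base := Fin 4 → ℝ

/-- Symmetric bilinear forms on `ℝ⁴`, given by their components `g α β`. -/
def symForms : Submodule ℝ (Fin 4 → Fin 4 → ℝ) where
  carrier := {g | ∀ α β, g α β = g β α}
  add_mem' := by
    intro a b ha hb α β
    simp only [Pi.add_apply, ha α β, hb α β]
  zero_mem' := fun _ _ => rfl
  smul_mem' := by
    intro c a ha α β
    simp only [Pi.smul_apply, ha α β]

/-- The vector space of symmetric bilinear forms on `ℝ⁴` (dimension 10). -/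
abbrev Sym := ↥symForms

/-- Christoffel symbols; `Γ α β γ` is `Γ^α_{βγ}`, with no symmetry in `β, γ`. -/
abbrev Conn := Fin 4 → Fin 4 → Fin 4 → ℝ

/-- Fibre coordinates `(g_{αβ}, Γ^α_{βγ})`. -/
abbrev Fib := Sym × Conn

/-- Coordinates `(x, g, Γ)` of a point of `E`. -/
abbrev EPt := Base × Fib

/-- Coordinates of a point of `J¹π`: `(x, y, v)` with `y = (g, Γ)` and
`v μ = (g_{αβ,μ}, Γ^α_{βγ,μ})`. -/
abbrev JPt := Base × Fib × (Fin 4 → Fib)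

/-- The projection `π¹ : J¹π → E` in coordinates. -/
def toE (p : JPt) : EPt := (p.1, p.2.1)

/-- The coordinate function `g_{αβ}`. -/
def metric (p : JPt) (α β : Fin 4) : ℝ := p.2.1.1.1 α β

/-- The coordinate function `Γ^α_{βγ}`. -/
def gam (p : JPt) (α β γ : Fin 4) : ℝ := p.2.1.2 α β γ

/-- The coordinate function `g_{αβ,μ}`. -/
def dmetric (p : JPt) (α β μ : Fin 4) : ℝ := (p.2.2 μ).1.1 α β

/-- The coordinate function `Γ^α_{βγ,μ}`. -/
def dgam (p : JPt) (α β γ μ : Fin 4) : ℝ := (p.2.2 μ).2 α β γ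

/-- Kronecker's delta. -/
def delta (α β : Fin 4) : ℝ := if α = β then 1 else 0

/-- The basis vector `∂/∂x^μ` of the model space. -/
def bvec (μ : Fin 4) : Base := Pi.single μ 1

/-- Lorentzian forms, of signature `(-+++)`: there is a vector on which `g` is negative and on
whose orthogonal complement `g` is positive definite. -/
def IsLorentzian (g : Sym) : Prop :=
  ∃ t : Base, (∑ α, ∑ β, g.1 α β * t α * t β) < 0 ∧
    ∀ w : Base, w ≠ 0 → (∑ α, ∑ β, g.1 α β * t α * w β) = 0 →
      0 < ∑ α, ∑ β, g.1 α β * w α * w β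

/-- The part of `E` over a coordinate domain whose image in `ℝ⁴` is `U`. -/
def eDom (U : Set Base) : Set EPt := {q | q.1 ∈ U ∧ IsLorentzian q.2.1}

/-- The part of `J¹π` over a coordinate domain whose image in `ℝ⁴` is `U`. -/
def jDom (U : Set Base) : Set JPt := {p | toE p ∈ eDom U}

/-- The coordinate total derivative `D_μ f` of a function `f` on `E`, a function on `J¹π`. -/
def totalD {F : Type*} [NormedAddCommGroup F] [NormedSpace ℝ F] (f : EPt → F) (μ : Fin 4)
    (p : JPt) : F :=
  fderiv ℝ f (toE p) (bvec μ, p.2.2 μ)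

/-- The coordinate expression of the canonical lift (prolongation) `j¹Y` of a vector field
`Y = ξ^μ ∂/∂x^μ + η^A ∂/∂y^A` on `E`:
the coefficient of `∂/∂y^A_μ` is `D_μ η^A - y^A_ν D_μ ξ^ν`. -/
def prolong (Y : EPt → EPt) (p : JPt) : JPt :=
  ((Y (toE p)).1, (Y (toE p)).2,
    fun μ => totalD (fun q => (Y q).2) μ p -
      ∑ ν, (totalD (fun q => (Y q).1) μ p ν) • p.2.2 ν)

/-! ### The Lagrangian and the Poincaré-Cartan forms -/

/-- `ϱ = √|det g|`. -/
def rho (p : JPt) : ℝ := Real.sqrt |(Matrix.of (metric p)).det|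

/-- The inverse metric `g^{αβ}`. -/
def invMetric (p : JPt) (α β : Fin 4) : ℝ := (Matrix.of (metric p))⁻¹ α β

/-- The Ricci tensor `R_{αβ}` of the connection. -/
def ricci (p : JPt) (α β : Fin 4) : ℝ :=
  (∑ γ, dgam p γ β α γ) - (∑ γ, dgam p γ γ α β)
    + (∑ γ, ∑ σ, gam p γ β α * gam p σ σ γ) - ∑ γ, ∑ σ, gam p γ β σ * gam p σ γ α

/-- The Einstein-Palatini Lagrangian function `ϱ g^{αβ} R_{αβ}`; the Lagrangian density is
`ϱ g^{αβ} R_{αβ} d⁴x`. -/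
def lagrangian (p : JPt) : ℝ := rho p * ∑ α, ∑ β, invMetric p α β * ricci p α β

/-- The momenta `∂L/∂y^A_μ`, as a linear form on the fibre directions. -/
def momentum (L : JPt → ℝ) (μ : Fin 4) (p : JPt) : Fib →L[ℝ] ℝ :=
  (fderiv ℝ L p).comp ((ContinuousLinearMap.inr ℝ Base (Fib × (Fin 4 → Fib))).comp
    ((ContinuousLinearMap.inr ℝ Fib (Fin 4 → Fib)).comp
      (ContinuousLinearMap.single ℝ (fun _ : Fin 4 => Fib) μ)))

/-- The function `(∂L/∂y^A_μ) y^A_μ - L`. -/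
def energy (L : JPt → ℝ) (p : JPt) : ℝ := (∑ μ, momentum L μ p (p.2.2 μ)) - L p

/-- The determinant as a continuous alternating form on `ℝ⁴`. -/
def detForm : Base [⋀^Fin 4]→L[ℝ] ℝ :=
  { (Matrix.detRowAlternating : Base [⋀^Fin 4]→ₗ[ℝ] ℝ) with
    cont := by
      change Continuous fun v : Fin 4 → Base => Matrix.det (Matrix.of v)
      exact Continuous.matrix_det continuous_id }

/-- The 4-form `θ 0 ∧ θ 1 ∧ θ 2 ∧ θ 3` on the coordinate space of `J¹π`. -/
def wedge (θ : Fin 4 → (JPt →L[ℝ] ℝ)) : JPt [⋀^Fin 4]→L[ℝ] ℝ :=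
  detForm.compContinuousLinearMap (ContinuousLinearMap.pi θ)

/-- The 1-form `dx^μ`. -/
def dx (μ : Fin 4) : JPt →L[ℝ] ℝ :=
  (ContinuousLinearMap.proj μ).comp (ContinuousLinearMap.fst ℝ Base (Fib × (Fin 4 → Fib)))

/-- The `Fib`-valued 1-form `dy = (dg_{αβ}, dΓ^α_{βγ})`. -/
def dy : JPt →L[ℝ] Fib :=
  (ContinuousLinearMap.fst ℝ Fib (Fin 4 → Fib)).comp
    (ContinuousLinearMap.snd ℝ Base (Fib × (Fin 4 → Fib)))

/-- The 4-form `θ ∧ d³x_μ`, where `d³x_μ = i(∂/∂x^μ) d⁴x`: the factor `dx^μ` of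
`dx⁰ ∧ dx¹ ∧ dx² ∧ dx³` is replaced by `θ`. -/
def wedge3 (θ : JPt →L[ℝ] ℝ) (μ : Fin 4) : JPt [⋀^Fin 4]→L[ℝ] ℝ :=
  wedge (Function.update dx μ θ)

/-- The Poincaré-Cartan 4-form
`Θ_L = (∂L/∂y^A_μ) dy^A ∧ d³x_μ - ((∂L/∂y^A_μ) y^A_μ - L) d⁴x` of a Lagrangian `L d⁴x`. -/
def poincareCartan (L : JPt → ℝ) (p : JPt) : JPt [⋀^Fin 4]→L[ℝ] ℝ :=
  (∑ μ, wedge3 ((momentum L μ p).comp dy) μ) - energy L p • wedge dx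

/-- The Poincaré-Cartan 5-form `Ω = -dΘ` of the Einstein-Palatini Lagrangian. -/
def omega (p : JPt) : JPt [⋀^Fin 5]→L[ℝ] ℝ := -extDeriv (poincareCartan lagrangian) p

/-! ### The final constraint submanifold -/

/-- The coordinate vector `∂/∂Γ^α_{βγ}` of the space of Christoffel symbols. -/
def gamUnit (α β γ : Fin 4) : Conn := Pi.single α (Pi.single β (Pi.single γ 1))

/-- The coordinate vector `∂/∂g_{μν}` (`μ ≤ ν`) of the space of symmetric forms: the form whose
components are `1` at `(μ, ν)` and `(ν, μ)` and `0` elsewhere. -/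
def symUnit (μ ν : Fin 4) : Sym :=
  ⟨fun α β => if (α = μ ∧ β = ν) ∨ (α = ν ∧ β = μ) then 1 else 0, by
    intro α β
    have h : ((α = μ ∧ β = ν) ∨ (α = ν ∧ β = μ)) ↔ ((β = μ ∧ α = ν) ∨ (β = ν ∧ α = μ)) := by
      tauto
    simp only [h]⟩

/-- The function `∂f/∂g_{μν}` on `J¹π`. -/
def partialG (f : JPt → ℝ) (μ ν : Fin 4) (p : JPt) : ℝ := fderiv ℝ f p (0, (symUnit μ ν, 0), 0)

/-- `L_α^{βγ,μ} = ∂L/∂Γ^α_{βγ,μ}`. -/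
def lagMom (α β γ μ : Fin 4) (p : JPt) : ℝ :=
  fderiv ℝ lagrangian p (0, 0, Pi.single μ (0, gamUnit α β γ))

/-- `H = L_α^{βγ,μ} Γ^α_{βγ,μ} - L`. -/
def ham (p : JPt) : ℝ :=
  (∑ α, ∑ β, ∑ γ, ∑ μ, lagMom α β γ μ p * dgam p α β γ μ) - lagrangian p

/-- The torsion `T^α_{βγ} = Γ^α_{βγ} - Γ^α_{γβ}` of an array of Christoffel symbols. -/
def torsion (G : Conn) (α β γ : Fin 4) : ℝ := G α β γ - G α γ β

/-- The trace `T^ν_{νγ}` of the torsion. -/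
def torsionTrace (G : Conn) (γ : Fin 4) : ℝ := ∑ ν, torsion G ν ν γ

/-- `T^α_{βγ} - ⅓ δ^α_β T^ν_{νγ} + ⅓ δ^α_γ T^ν_{νβ}`. -/
def torsionDefect (G : Conn) (α β γ : Fin 4) : ℝ :=
  torsion G α β γ - 1 / 3 * delta α β * torsionTrace G γ + 1 / 3 * delta α γ * torsionTrace G β

/-- The connection constraints (Euler-Lagrange equations of the metric)
`c^{μν} = ∂H/∂g_{μν} - (∂L_α^{βγ,σ}/∂g_{μν}) Γ^α_{βγ,σ}`. -/
def consC (μ ν : Fin 4) (p : JPt) : ℝ :=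
  partialG ham μ ν p -
    ∑ α, ∑ β, ∑ γ, ∑ σ, partialG (lagMom α β γ σ) μ ν p * dgam p α β γ σ

/-- The pre-metricity constraints
`m_{ρσ,μ} = g_{ρσ,μ} - g_{σλ} Γ^λ_{μρ} - g_{ρλ} Γ^λ_{μσ} - ⅔ g_{ρσ} T^λ_{λμ}`. -/
def consM (ρ σ μ : Fin 4) (p : JPt) : ℝ :=
  dmetric p ρ σ μ - (∑ l, metric p σ l * gam p l μ ρ) - (∑ l, metric p ρ l * gam p l μ σ)
    - 2 / 3 * metric p ρ σ * torsionTrace p.2.1.2 μ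

/-- The torsion constraints `t^α_{βγ}`. -/
def consT (α β γ : Fin 4) (p : JPt) : ℝ := torsionDefect p.2.1.2 α β γ

/-- The constraints `r^α_{βγ,ν} = T^α_{βγ,ν} - ⅓ δ^α_β T^μ_{μγ,ν} + ⅓ δ^α_γ T^μ_{μβ,ν}`. -/
def consR (α β γ ν : Fin 4) (p : JPt) : ℝ := torsionDefect (p.2.2 ν).2 α β γ

/-- The integrability constraints
`i_{ρσ,μν} = g_{ρκ} Γ^κ_{[νλ} Γ^λ_{μ]σ} + g_{σκ} Γ^κ_{[νλ} Γ^λ_{μ]ρ} + g_{ρλ} Γ^λ_{[μσ,ν]}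
+ g_{σλ} Γ^λ_{[μρ,ν]} + ⅔ g_{ρσ} T^λ_{λ[μ,ν]}`, where brackets antisymmetrise the outermost of
the enclosed indices, without a factor `½`. -/
def consI (ρ σ μ ν : Fin 4) (p : JPt) : ℝ :=
  (∑ κ, ∑ l, metric p ρ κ * (gam p κ ν l * gam p l μ σ - gam p κ μ l * gam p l ν σ))
    + (∑ κ, ∑ l, metric p σ κ * (gam p κ ν l * gam p l μ ρ - gam p κ μ l * gam p l ν ρ))
    + (∑ l, metric p ρ l * (dgam p l μ σ ν - dgam p l ν σ μ))
    + (∑ l, metric p σ l * (dgam p l μ ρ ν - dgam p l ν ρ μ))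
    + 2 / 3 * metric p ρ σ * (torsionTrace (p.2.2 ν).2 μ - torsionTrace (p.2.2 μ).2 ν)

/-- The set of all constraint functions. -/
def constraints : Set (JPt → ℝ) :=
  {φ | (∃ μ ν, φ = consC μ ν) ∨ (∃ ρ σ μ, φ = consM ρ σ μ) ∨ (∃ α β γ, φ = consT α β γ) ∨
    (∃ α β γ ν, φ = consR α β γ ν) ∨ ∃ ρ σ μ ν, φ = consI ρ σ μ ν}

/-- The final constraint submanifold `S_f` over a coordinate domain with image `U`. -/
def finalSet (U : Set Base) : Set JPt := {p | p ∈ jDom U ∧ ∀ φ ∈ constraints, φ p = 0}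

/-- Tangency to `S_f` at a point `p` of it: the vector is annihilated by the differentials of all
the constraints. -/
def IsTangent (p u : JPt) : Prop := ∀ φ ∈ constraints, fderiv ℝ φ p u = 0

/-- The condition `j_f^* (i(u) Ω) = 0` at a point `p` of `S_f`: the 4-form `i(u) Ω` vanishes on
the vectors tangent to `S_f`. -/
def InKernel (p u : JPt) : Prop :=
  ∀ w : Fin 4 → JPt, (∀ i, IsTangent p (w i)) → omega p (Matrix.vecCons u w) = 0

/-! ### The changes of coordinates of `E` and `J¹π` -/

/-- `∂τ^α/∂x^λ`. -/
def jac (τ : Base → Base) (x : Base) (α l : Fin 4) : ℝ := fderiv ℝ τ x (bvec l) α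

/-- `∂²τ^α/∂x^β∂x^γ`. -/
def hess (τ : Base → Base) (x : Base) (α β γ : Fin 4) : ℝ :=
  fderiv ℝ (fun z => fderiv ℝ τ z (bvec γ) α) x (bvec β)

/-- The change of the coordinates `(x, g, Γ)` of `E` induced by a change of coordinates
`x' = τ(x)`:
`g'_{αβ} = (∂x^μ/∂x'^α)(∂x^ν/∂x'^β) g_{μν}` and
`Γ'^α_{βγ} = (∂x'^α/∂x^λ) ((∂x^μ/∂x'^β)(∂x^ν/∂x'^γ) Γ^λ_{μν} + ∂²x^λ/∂x'^β∂x'^γ)`. -/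
def liftE (τ : OpenPartialHomeomorph Base Base) (q : EPt) : EPt :=
  (τ q.1,
    ⟨fun α β => ∑ μ, ∑ ν, jac τ.symm (τ q.1) μ α * jac τ.symm (τ q.1) ν β * q.2.1.1 μ ν, by
      intro α β
      beta_reduce
      rw [Finset.sum_comm]
      refine Finset.sum_congr rfl fun μ _ => Finset.sum_congr rfl fun ν _ => ?_
      rw [q.2.1.2 ν μ]
      ring⟩,
    fun α β γ => ∑ l, jac τ q.1 α l *
      ((∑ μ, ∑ ν, jac τ.symm (τ q.1) μ β * jac τ.symm (τ q.1) ν γ * q.2.2 l μ ν)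
        + hess τ.symm (τ q.1) l β γ))

/-- The change of the coordinates of `J¹π` induced by a change of coordinates `x' = τ(x)`, that
is, the first jet prolongation of `liftE τ`: `y'_{,μ} = (∂x^ν/∂x'^μ) D_ν y'`. -/
def liftJ (τ : OpenPartialHomeomorph Base Base) (p : JPt) : JPt :=
  ((liftE τ (toE p)).1, (liftE τ (toE p)).2,
    fun μ => ∑ ν, jac τ.symm (τ p.1) ν μ • totalD (fun q => (liftE τ q).2) ν p)

/-! ### Vector fields on `E` and on `J¹π`

A smooth vector field is given by its local expressions in the charts of `E` (of `J¹π`) induced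
by the charts of `M`; these are smooth and related by the changes of coordinates. -/

section Global

variable (M : Type*) [TopologicalSpace M] [ChartedSpace Base M]

/-- The charts of the smooth manifold `M`. -/
def Charts : Set (OpenPartialHomeomorph M Base) := IsManifold.maximalAtlas 𝓘(ℝ, Base) ∞ M

/-- Smooth vector fields on `E`. -/
structure EField where
  /-- The local expression in a chart. -/
  loc : OpenPartialHomeomorph M Base → EPt → EPt
  smooth : ∀ e ∈ Charts M, ContDiffOn ℝ ∞ (loc e) (eDom e.target)
  compat : ∀ e ∈ Charts M, ∀ e' ∈ Charts M, ∀ q ∈ eDom (e.symm.trans e').source,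
    fderiv ℝ (liftE (e.symm.trans e')) q (loc e q) = loc e' (liftE (e.symm.trans e') q)

/-- Smooth vector fields on `J¹π`. -/
structure JField where
  /-- The local expression in a chart. -/
  loc : OpenPartialHomeomorph M Base → JPt → JPt
  smooth : ∀ e ∈ Charts M, ContDiffOn ℝ ∞ (loc e) (jDom e.target)
  compat : ∀ e ∈ Charts M, ∀ e' ∈ Charts M, ∀ p ∈ jDom (e.symm.trans e').source,
    fderiv ℝ (liftJ (e.symm.trans e')) p (loc e p) = loc e' (liftJ (e.symm.trans e') p)

/-- Smooth horizontal (semibasic) 1-forms `C_β dx^β` on `E`, given by their components. -/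
structure HorizontalForm where
  /-- The components `C_β` in a chart, functions on `E`. -/
  comp : OpenPartialHomeomorph M Base → EPt → Fin 4 → ℝ
  smooth : ∀ e ∈ Charts M, ContDiffOn ℝ ∞ (comp e) (eDom e.target)
  compat : ∀ e ∈ Charts M, ∀ e' ∈ Charts M, ∀ q ∈ eDom (e.symm.trans e').source, ∀ β,
    comp e q β = ∑ γ, comp e' (liftE (e.symm.trans e') q) γ * jac (e.symm.trans e') q.1 γ β

variable {M}

/-- `X` is tangent to `S_f`. -/
def JField.TangentToFinal (X : JField M) : Prop :=
  ∀ e ∈ Charts M, ∀ p ∈ finalSet e.target, IsTangent p (X.loc e p)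

/-- Geometric gauge vector fields: `X` is tangent to `S_f` and `j_f^* (i(X) Ω) = 0`. -/
def JField.IsGauge (X : JField M) : Prop :=
  X.TangentToFinal ∧ ∀ e ∈ Charts M, ∀ p ∈ finalSet e.target, InKernel p (X.loc e p)

/-- `X` is vertical for the projection `J¹π → M`. -/
def JField.IsVertical (X : JField M) : Prop :=
  ∀ e ∈ Charts M, ∀ p ∈ jDom e.target, (X.loc e p).1 = 0

/-- `X` is natural: the canonical lift of a vector field on `E`. -/
def JField.IsNatural (X : JField M) : Prop :=
  ∃ Y : EField M, ∀ e ∈ Charts M, ∀ p ∈ jDom e.target, X.loc e p = prolong (Y.loc e) p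

/-- Natural gauge vector fields. -/
def JField.IsNaturalGauge (X : JField M) : Prop := X.IsGauge ∧ X.IsVertical ∧ X.IsNatural

end Global

/-! ### Trace and torsion solutions -/

/-- The trace array `C_β δ^α_γ`. -/
def traceArray (C : Fin 4 → ℝ) : Conn := fun α β γ => C β * delta α γ

/-- The vector `C_β δ^α_γ ∂/∂Γ^α_{βγ} + D_μ C_β δ^α_γ ∂/∂Γ^α_{βγ,μ}` at `p`. -/
def gaugeVector (C : EPt → Fin 4 → ℝ) (p : JPt) : JPt :=
  (0, (0, traceArray (C (toE p))), fun μ => (0, traceArray (totalD C μ p)))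

/-- Torsion-type arrays: `K^α_{βγ} = -K^α_{γβ}` and `K^ν_{νγ} = 0`. -/
def IsTorsionType (K : Conn) : Prop :=
  (∀ α β γ, K α β γ = -K α γ β) ∧ ∀ γ, ∑ ν, K ν ν γ = 0

end

end EinsteinPalatini

/-! The Lagrangian is affine in the derivatives of `Γ`. With `a = ϱ g^{αβ}` (`density`) it is `a`
contracted with a linear expression in `∂Γ` plus a quadratic one in `Γ`, so the momenta depend on
`g` alone and the energy is minus the quadratic part. Contracting `Ω` with a vertical `u = (h, f,
w)` therefore leaves three terms (`omega_vertical`): the variation of `a` paired with `f`, the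
variation of `a` along `h` paired with `dΓ`, and the derivative of the energy along `u`. In
dimension four `density` is an involution, so its differential is invertible and variations of `g`
and of `a` are interchangeable.

To exploit the kernel equation one needs many vectors tangent to `S_f`. The constraints other than
`t` are affine in the jet coordinates: `m` is solved by the metric derivatives, `r` holds for
torsion-free derivatives of `Γ`, and these suffice to solve `i` and `c` too
(`exists_symmetric_conn`). Hence every variation preserving `t = 0` lifts to a tangent vector
(`exists_isTangent`), and `S_f` projects onto `t = 0` (`exists_mem_finalSet`). Testing on such
vectors (`InKernel.mom_eq`) separates the first two terms and forces `h = 0` and `f` = trace +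
torsion. Conversely the momenta do not see such `f`, and the energy is stationary along it when `t =
0`. The differential of `t` is `2K` on trace + torsion vectors, so tangency removes `K`.

Trace transformations preserve all the constraints, and prolongation commutes with changes of charts
(`fderiv_liftJ_prolong`), so every horizontal form gives a natural gauge field. Conversely, if `X =
j¹Y`, the pointwise result makes `Y` a trace field over `t = 0`. Its coefficient is `-1/3` of the
torsion trace of `Y`, which is tensorial and so defines a smooth form on all of `E`. The constraints
`t` and `r` keep the total-derivative directions inside the locus `t = 0`, so the derivative
components agree as well (`prolong_eq_gaugeVector`). -/

namespace EinsteinPalatini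

noncomputable section

/-! ### Symmetric forms -/

/-- The symmetric part of an array. -/
def symmetrize : (Fin 4 → Fin 4 → ℝ) →L[ℝ] Sym :=
  LinearMap.toContinuousLinearMap
    { toFun := fun m => ⟨fun α β => (m α β + m β α) / 2, fun α β => by ring⟩
      map_add' := fun a b => by
        ext α β
        simp only [Pi.add_apply, Submodule.coe_add]
        ring
      map_smul' := fun c a => by
        ext α β
        simp only [Pi.smul_apply, Submodule.coe_smul, smul_eq_mul, RingHom.id_apply]
        ring }

@[simp]
theorem symmetrize_apply (m : Fin 4 → Fin 4 → ℝ) (α β : Fin 4) :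
    (symmetrize m).1 α β = (m α β + m β α) / 2 := rfl

theorem symmetrize_coe (g : Sym) : symmetrize g.1 = g := by
  ext α β
  rw [symmetrize_apply, g.2 β α]
  ring

/-- The component `g α β` as a continuous linear form. -/
def symCoord (α β : Fin 4) : Sym →L[ℝ] ℝ :=
  (ContinuousLinearMap.proj (R := ℝ) (φ := fun _ : Fin 4 => ℝ) β).comp
    ((ContinuousLinearMap.proj (R := ℝ) (φ := fun _ : Fin 4 => Fin 4 → ℝ) α).comp symForms.subtypeL)

@[simp]
theorem symCoord_apply (α β : Fin 4) (g : Sym) : symCoord α β g = g.1 α β := rfl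

theorem contDiffAt_sym {E : Type*} [NormedAddCommGroup E] [NormedSpace ℝ E] {n : ℕ∞ω}
    {f : E → Sym} {x : E} (h : ∀ α β, ContDiffAt ℝ n (fun y => (f y).1 α β) x) :
    ContDiffAt ℝ n f x := by
  have : f = fun y => symmetrize (f y).1 := funext fun y => (symmetrize_coe _).symm
  rw [this]
  refine symmetrize.contDiff.contDiffAt.comp x ?_
  exact contDiffAt_pi.2 fun α => contDiffAt_pi.2 fun β => h α β

/-! ### The metric density `√|det g| g⁻¹` -/

theorem symmMatrix_isSymm (g : Sym) : (Matrix.of g.1).transpose = Matrix.of g.1 := by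
  ext α β
  exact g.2 β α

/-- The contravariant metric density `√|det g| g^{αβ}`. -/
def density (g : Sym) : Sym :=
  ⟨fun α β => Real.sqrt |(Matrix.of g.1).det| * (Matrix.of g.1)⁻¹ α β, fun α β => by
    have h : ((Matrix.of g.1)⁻¹).transpose = (Matrix.of g.1)⁻¹ := by
      rw [Matrix.transpose_nonsing_inv, symmMatrix_isSymm]
    have h' := congrFun (congrFun h β) α
    rw [Matrix.transpose_apply] at h'
    beta_reduce
    rw [h']⟩

theorem density_coe (g : Sym) :
    Matrix.of (density g).1 = Real.sqrt |(Matrix.of g.1).det| • (Matrix.of g.1)⁻¹ := rfl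

/-- Dimension four is essential: the scalar factor enters to the fourth power, giving `|det g|² /
det g`. -/
theorem det_density {g : Sym} (hg : (Matrix.of g.1).det ≠ 0) :
    (Matrix.of (density g).1).det = (Matrix.of g.1).det := by
  rw [density_coe, Matrix.det_smul, Matrix.det_nonsing_inv, Fintype.card_fin,
    show ∀ x : ℝ, x ^ 4 = (x ^ 2) ^ 2 from fun x => by ring, Real.sq_sqrt (abs_nonneg _), sq_abs,
    Ring.inverse_eq_inv']
  field_simp

theorem density_density {g : Sym} (hg : (Matrix.of g.1).det ≠ 0) : density (density g) = g := by
  have hs : Real.sqrt |(Matrix.of g.1).det| ≠ 0 := by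
    rw [Ne, Real.sqrt_eq_zero (abs_nonneg _), abs_eq_zero]
    exact hg
  have h : Matrix.of (density (density g)).1 = Matrix.of g.1 := by
    rw [density_coe, det_density hg, density_coe]
    have hu : IsUnit (Matrix.of g.1).det := isUnit_iff_ne_zero.2 hg
    have : (Real.sqrt |(Matrix.of g.1).det| • (Matrix.of g.1)⁻¹)⁻¹ =
        (Real.sqrt |(Matrix.of g.1).det|)⁻¹ • Matrix.of g.1 := by
      apply Matrix.inv_eq_right_inv
      rw [Matrix.smul_mul, Matrix.mul_smul, smul_smul, mul_inv_cancel₀ hs, one_smul,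
        Matrix.nonsing_inv_mul _ hu]
    rw [this, smul_smul, mul_inv_cancel₀ hs, one_smul]
  exact Subtype.ext h

theorem contDiff_det {E : Type*} [NormedAddCommGroup E] [NormedSpace ℝ E] {n : ℕ∞ω}
    {f : E → Matrix (Fin 4) (Fin 4) ℝ} (h : ∀ α β, ContDiff ℝ n fun y => f y α β) :
    ContDiff ℝ n fun y => (f y).det := by
  simp only [Matrix.det_apply']
  exact ContDiff.sum fun σ _ => contDiff_const.mul (contDiff_prod fun i _ => h _ _)

theorem contDiff_detSym {n : ℕ∞ω} : ContDiff ℝ n fun g : Sym => (Matrix.of g.1).det :=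
  contDiff_det fun α β => (symCoord α β).contDiff

theorem contDiffAt_density {n : ℕ∞} {g : Sym} (hg : (Matrix.of g.1).det ≠ 0) :
    ContDiffAt ℝ n density g := by
  refine contDiffAt_sym fun α β => ?_
  have hd : ContDiffAt ℝ n (fun g : Sym => (Matrix.of g.1).det) g := contDiff_detSym.contDiffAt
  refine ((hd.abs hg).sqrt (abs_ne_zero.2 hg)).mul ?_
  simp only [Matrix.inv_def, Ring.inverse_eq_inv', Matrix.smul_apply, smul_eq_mul]
  refine (hd.inv hg).mul ?_
  simp only [Matrix.adjugate_apply]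
  refine (contDiff_det fun i j => ?_).contDiffAt
  simp only [Matrix.updateRow_apply]
  split_ifs
  · exact contDiff_const
  · exact (symCoord i j).contDiff

theorem isOpen_det_ne_zero : IsOpen {g : Sym | (Matrix.of g.1).det ≠ 0} :=
  isOpen_ne_fun (contDiff_detSym (n := 0)).continuous continuous_const

/-- The differential of `density` is invertible. -/
theorem fderiv_density_fderiv_density {g : Sym} (hg : (Matrix.of g.1).det ≠ 0) (h : Sym) :
    fderiv ℝ density (density g) (fderiv ℝ density g h) = h := by
  have h1 : HasFDerivAt density (fderiv ℝ density g) g :=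
    ((contDiffAt_density (n := 1) hg).differentiableAt one_ne_zero).hasFDerivAt
  have h2 : HasFDerivAt density (fderiv ℝ density (density g)) (density g) :=
    ((contDiffAt_density (n := 1) (by rwa [det_density hg])).differentiableAt
      one_ne_zero).hasFDerivAt
  have h3 : HasFDerivAt (density ∘ density) (ContinuousLinearMap.id ℝ Sym) g := by
    refine (hasFDerivAt_id g).congr_of_eventuallyEq ?_
    filter_upwards [isOpen_det_ne_zero.mem_nhds hg] with k hk using density_density hk
  exact congrArg (fun A : Sym →L[ℝ] Sym => A h) ((h2.comp g h1).unique h3)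

theorem fderiv_density_injective {g : Sym} (hg : (Matrix.of g.1).det ≠ 0) :
    Function.Injective (fderiv ℝ density g) :=
  Function.LeftInverse.injective (fderiv_density_fderiv_density hg)

theorem fderiv_density_surjective {g : Sym} (hg : (Matrix.of g.1).det ≠ 0) :
    Function.Surjective (fderiv ℝ density g) := fun h =>
  ⟨fderiv ℝ density (density g) h, by
    have := fderiv_density_fderiv_density (g := density g) (by rwa [det_density hg]) h
    rwa [density_density hg] at this⟩

/-! ### Lorentzian forms -/

/-- A null vector of the matrix would be orthogonal to `t`, hence of positive square, while its
square is zero. -/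
theorem IsLorentzian.det_ne_zero {g : Sym} (hg : IsLorentzian g) : (Matrix.of g.1).det ≠ 0 := by
  obtain ⟨t, -, ht⟩ := hg
  intro h0
  obtain ⟨v, hv, hv0⟩ := Matrix.exists_mulVec_eq_zero_iff.2 h0
  have hv1 : ∀ α, ∑ β, g.1 α β * v β = 0 := fun α => congrFun hv0 α
  have key : ∀ w : Base, ∑ α, ∑ β, g.1 α β * w α * v β = 0 := fun w => by
    refine Finset.sum_eq_zero fun α _ => ?_
    rw [← mul_zero (w α), ← hv1 α, Finset.mul_sum]
    exact Finset.sum_congr rfl fun β _ => by ring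
  exact absurd (ht v hv (key t)) (by rw [key v]; exact lt_irrefl _)

/-- The value `g(v, w)` of a symmetric form. -/
def form (g : Sym) (v w : Base) : ℝ := ∑ α, ∑ β, g.1 α β * v α * w β

theorem form_comm (g : Sym) (v w : Base) : form g v w = form g w v := by
  unfold form
  rw [Finset.sum_comm]
  refine Finset.sum_congr rfl fun β _ => Finset.sum_congr rfl fun α _ => ?_
  rw [g.2 α β]
  ring

theorem form_add_right (g : Sym) (v w w' : Base) :
    form g v (w + w') = form g v w + form g v w' := by
  simp only [form, Pi.add_apply, mul_add, Finset.sum_add_distrib]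

theorem form_smul_right (g : Sym) (v w : Base) (c : ℝ) : form g v (c • w) = c * form g v w := by
  simp only [form, Pi.smul_apply, smul_eq_mul, Finset.mul_sum]
  exact Finset.sum_congr rfl fun α _ => Finset.sum_congr rfl fun β _ => by ring

theorem form_add_smul_self (g : Sym) (v t : Base) (c : ℝ) :
    form g (v + c • t) (v + c • t) = form g v v + 2 * c * form g t v + c * c * form g t t := by
  rw [form_add_right, form_smul_right, form_comm g _ v, form_comm g _ t, form_add_right,
    form_smul_right, form_add_right, form_smul_right, form_comm g v t]
  ring

/-- The auxiliary form `2 g(t,w)² - g(t,t) g(w,w)` reduces to `-g(t,t) g(w,w)` on the orthogonal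
complement of `t`. Its positivity is a condition on a fixed compact sphere, whereas the complement
itself moves with `g`; this is what gives openness. -/
theorem isLorentzian_of_posDef {g : Sym} {t : Base} (ht : form g t t < 0)
    (h : ∀ w ∈ Metric.sphere (0 : Base) 1, 0 < 2 * form g t w ^ 2 - form g t t * form g w w) :
    IsLorentzian g := by
  refine ⟨t, ht, fun w hw h0 => ?_⟩
  change form g t w = 0 at h0
  change 0 < form g w w
  have hn : 0 < ‖w‖ := norm_pos_iff.2 hw
  have h1 := h (‖w‖⁻¹ • w) (by
    rw [mem_sphere_zero_iff_norm, norm_smul, norm_inv, norm_norm, inv_mul_cancel₀ hn.ne'])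
  rw [form_smul_right, h0, form_smul_right, form_comm g _ w, form_smul_right] at h1
  have h2 : 0 < (-form g t t * (‖w‖⁻¹ * ‖w‖⁻¹)) * form g w w := by linarith
  have h3 : 0 < -form g t t * (‖w‖⁻¹ * ‖w‖⁻¹) := by
    have := inv_pos.2 hn
    have h4 : 0 < -form g t t := by linarith
    positivity
  exact (mul_pos_iff_of_pos_left h3).1 h2

theorem IsLorentzian.exists_posDef {g : Sym} (hg : IsLorentzian g) :
    ∃ t, form g t t < 0 ∧
      ∀ w : Base, w ≠ 0 → 0 < 2 * form g t w ^ 2 - form g t t * form g w w := by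
  obtain ⟨t, ht, hpos⟩ := hg
  change form g t t < 0 at ht
  refine ⟨t, ht, fun w hw => ?_⟩
  -- Splitting `w` into `w'` orthogonal to `t` and `c t` turns the auxiliary form into `(c g(t,t))²
  -- - g(t,t) g(w',w')`.
  set c := form g t w / form g t t with hc
  have hct : c * form g t t = form g t w := div_mul_cancel₀ _ ht.ne
  set w' := w + (-c) • t with hw'
  have hw2 : w = w' + c • t := by rw [hw']; module
  have h0 : form g t w' = 0 := by
    rw [hw', form_add_right, form_smul_right]
    linarith
  have hww : form g w w = form g w' w' + c * c * form g t t := by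
    rw [hw2, form_add_smul_self, h0]
    ring
  rw [hww, ← hct]
  by_cases h : w' = 0
  · have hc0 : c ≠ 0 := by
      rintro h'
      rw [h, h', zero_smul, add_zero] at hw2
      exact hw hw2
    have : form g w' w' = 0 := by simp [h, form]
    rw [this]
    have : 0 < (c * form g t t) ^ 2 := by
      have := mul_ne_zero hc0 ht.ne
      positivity
    nlinarith
  · have h1 : 0 < form g w' w' := hpos w' h h0
    nlinarith [mul_pos (neg_pos.2 ht) h1, sq_nonneg (c * form g t t)]

theorem continuous_form : Continuous fun q : Sym × Base × Base => form q.1 q.2.1 q.2.2 := by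
  unfold form
  refine continuous_finsetSum _ fun α _ => continuous_finsetSum _ fun β _ => ?_
  have h := (symCoord α β).continuous
  have h1 : Continuous fun q : Sym × Base × Base => q.1.1 α β := h.comp continuous_fst
  exact (h1.mul (by fun_prop)).mul (by fun_prop)

theorem isOpen_isLorentzian : IsOpen {g : Sym | IsLorentzian g} := by
  rw [isOpen_iff_mem_nhds]
  intro g hg
  obtain ⟨t, ht, hpos⟩ := IsLorentzian.exists_posDef hg
  have hc : ∀ {v w : Sym × Base → Base}, Continuous v → Continuous w →
      Continuous fun q : Sym × Base => form q.1 (v q) (w q) := fun hv hw =>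
    continuous_form.comp (continuous_fst.prodMk (hv.prodMk hw))
  have h1 : ∀ᶠ k in nhds g, form k t t < 0 := by
    have : Continuous fun k : Sym => form k t t :=
      (hc (v := fun _ => t) (w := fun _ => t) continuous_const continuous_const).comp
        (continuous_id.prodMk (continuous_const (y := (0 : Base))))
    exact this.continuousAt.eventually_lt continuousAt_const ht
  have h2 : ∀ᶠ k in nhds g, ∀ w ∈ Metric.sphere (0 : Base) 1,
      0 < 2 * form k t w ^ 2 - form k t t * form k w w := by
    refine (isCompact_sphere (0 : Base) 1).eventually_forall_of_forall_eventually fun w hw => ?_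
    have hcont : Continuous fun q : Sym × Base =>
        2 * form q.1 t q.2 ^ 2 - form q.1 t t * form q.1 q.2 q.2 :=
      (continuous_const.mul ((hc continuous_const continuous_snd).pow 2)).sub
        ((hc continuous_const continuous_const).mul (hc continuous_snd continuous_snd))
    refine continuousAt_const.eventually_lt hcont.continuousAt ?_
    exact hpos w (Metric.ne_of_mem_sphere hw one_ne_zero)
  filter_upwards [h1, h2] with k hk1 hk2 using isLorentzian_of_posDef hk1 hk2

theorem isOpen_eDom {U : Set Base} (hU : IsOpen U) : IsOpen (eDom U) :=
  (hU.preimage continuous_fst).inter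
    (isOpen_isLorentzian.preimage (continuous_fst.comp continuous_snd))

/-! ### Derivatives along lines -/

/-- Everything differentiated this way is polynomial of degree at most two along the relevant lines,
so the directional derivative can be read off as the linear coefficient. -/
theorem fderiv_apply_of_line {E F : Type*} [NormedAddCommGroup E] [NormedSpace ℝ E]
    [NormedAddCommGroup F] [NormedSpace ℝ F] {f : E → F} {p u : E} {a b : F}
    (hf : DifferentiableAt ℝ f p) (h : ∀ t : ℝ, f (p + t • u) = f p + t • a + t ^ 2 • b) :
    fderiv ℝ f p u = a := by
  have h1 : HasDerivAt (fun t : ℝ => f (p + t • u)) (fderiv ℝ f p u) 0 := by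
    have hl : HasDerivAt (fun t : ℝ => p + t • u) u 0 := by
      simpa using ((hasDerivAt_id (0 : ℝ)).smul_const u).const_add p
    have hf' : HasFDerivAt f (fderiv ℝ f p) (p + (0 : ℝ) • u) := by
      simpa using hf.hasFDerivAt
    exact hf'.comp_hasDerivAt 0 hl
  have h2 : HasDerivAt (fun t : ℝ => f p + t • a + t ^ 2 • b) a 0 := by
    have h3 := (((hasDerivAt_id (0 : ℝ)).smul_const a).const_add (f p)).fun_add
      (((hasDerivAt_id (0 : ℝ)).fun_pow 2).smul_const b)
    simpa using h3
  exact h1.unique (by simpa only [h] using h2)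

theorem fderiv_apply_eq_zero_of_line {E F : Type*} [NormedAddCommGroup E] [NormedSpace ℝ E]
    [NormedAddCommGroup F] [NormedSpace ℝ F] {f : E → F} {p u : E}
    (h : ∀ t : ℝ, f (p + t • u) = f p) : fderiv ℝ f p u = 0 := by
  by_cases hf : DifferentiableAt ℝ f p
  · exact fderiv_apply_of_line (b := 0) hf fun t => by simp [h t]
  -- Differentiability need not be assumed: `fderiv` takes the default value zero where it fails.
  · rw [fderiv_zero_of_not_differentiableAt hf]
    rfl

/-! ### Coordinate functions -/

@[fun_prop]
theorem contDiff_metric {n : ℕ∞ω} (α β : Fin 4) : ContDiff ℝ n fun p : JPt => metric p α β :=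
  ((symCoord α β).comp ((ContinuousLinearMap.fst ℝ Sym Conn).comp dy)).contDiff

@[fun_prop]
theorem contDiff_gam {n : ℕ∞ω} (α β γ : Fin 4) : ContDiff ℝ n fun p : JPt => gam p α β γ := by
  unfold gam
  fun_prop

theorem contDiff_dmetric {n : ℕ∞ω} (α β μ : Fin 4) :
    ContDiff ℝ n fun p : JPt => dmetric p α β μ := by
  have : ContDiff ℝ n fun p : JPt => (p.2.2 μ).1 := by fun_prop
  exact (symCoord α β).contDiff.comp this

@[fun_prop]
theorem contDiff_dgam {n : ℕ∞ω} (α β γ μ : Fin 4) :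
    ContDiff ℝ n fun p : JPt => dgam p α β γ μ := by
  unfold dgam
  fun_prop

/-! ### The curvature -/

/-- The part of the Ricci tensor that is linear in the derivatives of the connection. -/
def curvLin : (Fin 4 → Conn) →ₗ[ℝ] (Fin 4 → Fin 4 → ℝ) where
  toFun D α β := (∑ γ, D γ γ β α) - ∑ γ, D β γ γ α
  map_add' D D' := by
    ext α β
    simp only [Pi.add_apply, Finset.sum_add_distrib]
    ring
  map_smul' c D := by
    ext α β
    simp only [Pi.smul_apply, smul_eq_mul, RingHom.id_apply, ← Finset.mul_sum]
    ring

theorem curvLin_apply (D : Fin 4 → Conn) (α β : Fin 4) :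
    curvLin D α β = (∑ γ, D γ γ β α) - ∑ γ, D β γ γ α := rfl

/-- The part of the Ricci tensor that is quadratic in the connection. -/
def curvQuad (G : Conn) (α β : Fin 4) : ℝ :=
  (∑ γ, ∑ σ, G γ β α * G σ σ γ) - ∑ γ, ∑ σ, G γ β σ * G σ γ α

/-- The derivatives of the connection at a point of `J¹π`. -/
def jetConn (v : Fin 4 → Fib) : Fin 4 → Conn := fun μ => (v μ).2

theorem ricci_eq (p : JPt) (α β : Fin 4) :
    ricci p α β = curvLin (jetConn p.2.2) α β + curvQuad p.2.1.2 α β := by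
  rw [curvLin_apply, curvQuad, ← add_sub_assoc]
  rfl

@[fun_prop]
theorem contDiff_ricci {n : ℕ∞ω} (α β : Fin 4) : ContDiff ℝ n fun p : JPt => ricci p α β := by
  unfold ricci
  fun_prop

@[fun_prop]
theorem contDiff_curvQuad {n : ℕ∞ω} (α β : Fin 4) :
    ContDiff ℝ n fun p : JPt => curvQuad p.2.1.2 α β := by
  unfold curvQuad
  fun_prop

/-- The contraction `a^{αβ} b_{αβ}`. -/
def contr (a : Sym) : (Fin 4 → Fin 4 → ℝ) →ₗ[ℝ] ℝ where
  toFun b := ∑ α, ∑ β, a.1 α β * b α β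
  map_add' b b' := by simp only [Pi.add_apply, mul_add, Finset.sum_add_distrib]
  map_smul' c b := by
    simp only [Pi.smul_apply, smul_eq_mul, RingHom.id_apply, Finset.mul_sum]
    exact Finset.sum_congr rfl fun α _ => Finset.sum_congr rfl fun β _ => by ring

theorem contr_apply (a : Sym) (b : Fin 4 → Fin 4 → ℝ) :
    contr a b = ∑ α, ∑ β, a.1 α β * b α β := rfl

theorem contr_zero_left (b : Fin 4 → Fin 4 → ℝ) : contr 0 b = 0 := by
  simp [contr_apply]

/-- Only the symmetric part of `b` contributes to `a^{αβ} b_{αβ}`. -/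
theorem contr_eq_of_symmetric_part (a : Sym) {b b' : Fin 4 → Fin 4 → ℝ}
    (h : ∀ α β, b α β + b β α = b' α β + b' β α) : contr a b = contr a b' := by
  have key : ∀ c : Fin 4 → Fin 4 → ℝ, 2 * contr a c = ∑ α, ∑ β, a.1 α β * (c α β + c β α) := by
    intro c
    have : contr a c = ∑ α, ∑ β, a.1 α β * c β α := by
      rw [contr_apply, Finset.sum_comm]
      exact Finset.sum_congr rfl fun α _ => Finset.sum_congr rfl fun β _ => by rw [a.2 β α]
    rw [two_mul]
    nth_rewrite 2 [this]
    rw [contr_apply]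
    simp only [mul_add, Finset.sum_add_distrib]
  have h1 := key b
  simp only [h, ← key b'] at h1
  linarith

theorem lagrangian_eq (p : JPt) : lagrangian p = contr (density p.2.1.1) (ricci p) := by
  rw [lagrangian, contr_apply, Finset.mul_sum]
  refine Finset.sum_congr rfl fun α _ => ?_
  rw [Finset.mul_sum]
  exact Finset.sum_congr rfl fun β _ => (mul_assoc _ _ _).symm

theorem lagrangian_eq_add (p : JPt) : lagrangian p =
    contr (density p.2.1.1) (curvLin (jetConn p.2.2)) + contr (density p.2.1.1)
      (curvQuad p.2.1.2) := by
  rw [lagrangian_eq, ← map_add]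
  congr 1
  ext α β
  exact ricci_eq p α β

/-- The points of `J¹π` at which the metric is nondegenerate. -/
def regular : Set JPt := {p | (Matrix.of p.2.1.1.1).det ≠ 0}

theorem isOpen_regular : IsOpen regular :=
  isOpen_det_ne_zero.preimage (f := fun p : JPt => p.2.1.1) (by fun_prop)

theorem jDom_subset_regular (U : Set Base) : jDom U ⊆ regular := fun _ hp =>
  IsLorentzian.det_ne_zero hp.2

theorem contDiffAt_density_comp {n : ℕ∞} {p : JPt} (hp : p ∈ regular) :
    ContDiffAt ℝ n (fun p : JPt => density p.2.1.1) p :=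
  ContDiffAt.comp (g := density) p (contDiffAt_density hp) (by fun_prop)

theorem contDiffAt_contr {n : ℕ∞ω} {a : JPt → Sym} {c : JPt → Fin 4 → Fin 4 → ℝ} {p : JPt}
    (ha : ContDiffAt ℝ n a p) (hc : ∀ α β, ContDiffAt ℝ n (fun p => c p α β) p) :
    ContDiffAt ℝ n (fun p => contr (a p) (c p)) p := by
  simp only [contr_apply]
  refine ContDiffAt.sum fun α _ => ContDiffAt.sum fun β _ => ?_
  exact ((symCoord α β).contDiff.contDiffAt.comp p ha).mul (hc α β)

theorem contDiffAt_lagrangian {n : ℕ∞} {p : JPt} (hp : p ∈ regular) :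
    ContDiffAt ℝ n lagrangian p := by
  rw [funext lagrangian_eq]
  exact contDiffAt_contr (contDiffAt_density_comp hp) fun α β => (contDiff_ricci α β).contDiffAt

theorem fderiv_contr {a : JPt → Sym} {c : JPt → Fin 4 → Fin 4 → ℝ} {p : JPt}
    (ha : DifferentiableAt ℝ a p) (hc : ∀ α β, DifferentiableAt ℝ (fun p => c p α β) p) (u : JPt) :
    fderiv ℝ (fun p => contr (a p) (c p)) p u =
      contr (fderiv ℝ a p u) (c p) + contr (a p) fun α β => fderiv ℝ (fun p => c p α β) p u := by
  have h : ∀ α β, HasFDerivAt (fun p => (a p).1 α β * c p α β)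
      ((a p).1 α β • fderiv ℝ (fun p => c p α β) p +
        c p α β • (symCoord α β).comp (fderiv ℝ a p)) p := fun α β =>
    ((symCoord α β).hasFDerivAt.comp p ha.hasFDerivAt).mul (hc α β).hasFDerivAt
  have h2 := HasFDerivAt.fun_sum (u := Finset.univ) fun α _ =>
    HasFDerivAt.fun_sum (u := Finset.univ) fun β _ => h α β
  have h3 : fderiv ℝ (fun p => contr (a p) (c p)) p = _ := h2.fderiv
  rw [h3]
  simp only [contr_apply, sum_apply, ← Finset.sum_add_distrib]
  refine Finset.sum_congr rfl fun α _ => Finset.sum_congr rfl fun β _ => ?_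
  simp only [add_apply, smul_apply, smul_eq_mul,
    ContinuousLinearMap.comp_apply, symCoord_apply]
  ring

theorem fderiv_density_comp {p : JPt} (hp : p ∈ regular) (u : JPt) :
    fderiv ℝ (fun p : JPt => density p.2.1.1) p u = fderiv ℝ density p.2.1.1 u.2.1.1 := by
  have h1 : HasFDerivAt density (fderiv ℝ density p.2.1.1) p.2.1.1 :=
    ((contDiffAt_density (n := 1) hp).differentiableAt one_ne_zero).hasFDerivAt
  have h2 := HasFDerivAt.comp (g := density) p h1
    ((ContinuousLinearMap.fst ℝ Sym Conn).comp dy).hasFDerivAt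
  have h3 : fderiv ℝ (fun p : JPt => density p.2.1.1) p = _ := h2.fderiv
  rw [h3]
  rfl

theorem fderiv_contr_density {c : JPt → Fin 4 → Fin 4 → ℝ} {p : JPt} (hp : p ∈ regular)
    (hc : ∀ α β, DifferentiableAt ℝ (fun p => c p α β) p) (u : JPt) :
    fderiv ℝ (fun p : JPt => contr (density p.2.1.1) (c p)) p u =
      contr (fderiv ℝ density p.2.1.1 u.2.1.1) (c p) +
        contr (density p.2.1.1) fun α β => fderiv ℝ (fun p => c p α β) p u := by
  rw [fderiv_contr ((contDiffAt_density_comp (n := 1) hp).differentiableAt one_ne_zero) hc,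
    fderiv_density_comp hp]

/-! ### Momenta and Hamiltonian -/

theorem jetConn_single (μ : Fin 4) (y : Fib) : jetConn (Pi.single μ y) = Pi.single μ y.2 := by
  ext ν : 1
  rcases eq_or_ne ν μ with rfl | h
  · simp [jetConn]
  · simp [jetConn, h]

theorem jetConn_add_smul (v w : Fin 4 → Fib) (t : ℝ) :
    jetConn (v + t • w) = jetConn v + t • jetConn w := rfl

theorem fderiv_lagrangian_jet {p : JPt} (hp : p ∈ regular) (w : Fin 4 → Fib) :
    fderiv ℝ lagrangian p (0, 0, w) = contr (density p.2.1.1) (curvLin (jetConn w)) := by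
  refine fderiv_apply_of_line (b := 0)
    ((contDiffAt_lagrangian (n := 1) hp).differentiableAt one_ne_zero) fun t => ?_
  rw [lagrangian_eq_add, lagrangian_eq_add]
  simp only [Prod.fst_add, Prod.snd_add, Prod.smul_fst, Prod.smul_snd, smul_zero, add_zero, jetConn_add_smul, map_add, map_smul]
  ring

theorem momentum_lagrangian {p : JPt} (hp : p ∈ regular) (μ : Fin 4) (y : Fib) :
    momentum lagrangian μ p y = contr (density p.2.1.1) (curvLin (Pi.single μ y.2)) := by
  rw [← jetConn_single, ← fderiv_lagrangian_jet hp]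
  rfl

theorem sum_single {A : Type*} [AddCommMonoid A] (D : Fin 4 → A) : ∑ μ, Pi.single μ (D μ) = D :=
  Finset.univ_sum_single D

/-- The part of `L` linear in the derivatives is homogeneous of degree one, so by Euler's identity
it cancels. -/
theorem energy_lagrangian {p : JPt} (hp : p ∈ regular) :
    energy lagrangian p = -contr (density p.2.1.1) (curvQuad p.2.1.2) := by
  rw [energy, lagrangian_eq_add]
  simp only [momentum_lagrangian hp]
  rw [← map_sum, ← map_sum, sum_single fun μ => (p.2.2 μ).2]
  change contr _ (curvLin (jetConn p.2.2)) - _ = _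
  ring

theorem sum_smul_gamUnit (G : Conn) : ∑ α, ∑ β, ∑ γ, G α β γ • gamUnit α β γ = G := by
  ext a b c
  simp only [gamUnit, Finset.sum_apply, Pi.smul_apply, smul_eq_mul]
  simp [Pi.single_apply, apply_ite, ite_apply]

/-- Expansion of `D` in the coordinate basis; it turns index sums over momenta into basis-free
contractions. -/
theorem sum_contr_curvLin_unit (a : Sym) (D : Fin 4 → Conn) :
    ∑ α, ∑ β, ∑ γ, ∑ μ, contr a (curvLin (Pi.single μ (gamUnit α β γ))) * D μ α β γ =
      contr a (curvLin D) := by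
  have h : D = ∑ α, ∑ β, ∑ γ, ∑ μ, D μ α β γ • Pi.single μ (gamUnit α β γ) := by
    have h1 : ∀ α β γ, ∑ μ, D μ α β γ • (Pi.single μ (gamUnit α β γ) : Fin 4 → Conn) =
        fun μ => D μ α β γ • gamUnit α β γ := fun α β γ => by
      simp only [← Pi.single_smul]
      exact sum_single _
    simp only [h1]
    ext μ : 1
    simp only [Finset.sum_apply]
    exact (sum_smul_gamUnit (D μ)).symm
  conv_rhs => rw [h]
  simp only [map_sum, map_smul, smul_eq_mul]
  refine Finset.sum_congr rfl fun α _ => Finset.sum_congr rfl fun β _ =>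
    Finset.sum_congr rfl fun γ _ => Finset.sum_congr rfl fun μ _ => mul_comm _ _

theorem lagMom_eq {p : JPt} (hp : p ∈ regular) (α β γ μ : Fin 4) :
    lagMom α β γ μ p = contr (density p.2.1.1) (curvLin (Pi.single μ (gamUnit α β γ))) := by
  rw [lagMom, fderiv_lagrangian_jet hp, jetConn_single]

theorem ham_eq {p : JPt} (hp : p ∈ regular) :
    ham p = -contr (density p.2.1.1) (curvQuad p.2.1.2) := by
  rw [ham, lagrangian_eq_add]
  simp only [lagMom_eq hp]
  have h := sum_contr_curvLin_unit (density p.2.1.1) (jetConn p.2.2)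
  have h2 : ∀ α β γ μ, jetConn p.2.2 μ α β γ = dgam p α β γ μ := fun _ _ _ _ => rfl
  simp only [h2] at h
  rw [h]
  ring

theorem partialG_congr {f f' : JPt → ℝ} (h : Set.EqOn f f' regular) {p : JPt} (hp : p ∈ regular)
    (μ ν : Fin 4) : partialG f μ ν p = partialG f' μ ν p := by
  rw [partialG, partialG, (h.eventuallyEq_of_mem (isOpen_regular.mem_nhds hp)).fderiv_eq]

/-- The constraints `c^{μν}` are the Einstein equations. -/
theorem consC_eq {p : JPt} (hp : p ∈ regular) (μ ν : Fin 4) :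
    consC μ ν p = -contr (fderiv ℝ density p.2.1.1 (symUnit μ ν)) (ricci p) := by
  have hz : contr (density p.2.1.1) (fun _ _ => 0) = 0 := map_zero _
  have h1 : partialG ham μ ν p =
      -contr (fderiv ℝ density p.2.1.1 (symUnit μ ν)) (curvQuad p.2.1.2) := by
    rw [partialG_congr (f' := fun p => -contr (density p.2.1.1) (curvQuad p.2.1.2))
      (fun q hq => ham_eq hq) hp, partialG, fderiv_fun_neg, neg_apply,
      fderiv_contr_density hp
        (fun α β => (contDiff_curvQuad (n := 1) α β).contDiffAt.differentiableAt one_ne_zero)]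
    have : ∀ α β, fderiv ℝ (fun p : JPt => curvQuad p.2.1.2 α β) p (0, (symUnit μ ν, 0), 0) = 0 :=
      fun α β => fderiv_apply_eq_zero_of_line fun t => by simp
    simp only [this, hz, add_zero]
  have h2 : ∀ α β γ σ, partialG (lagMom α β γ σ) μ ν p =
      contr (fderiv ℝ density p.2.1.1 (symUnit μ ν)) (curvLin (Pi.single σ (gamUnit α β γ))) := by
    intro α β γ σ
    rw [partialG_congr (fun q hq => lagMom_eq hq α β γ σ) hp, partialG,
      fderiv_contr_density (c := fun _ => curvLin (Pi.single σ (gamUnit α β γ))) hp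
        fun _ _ => differentiableAt_const _]
    simp [hz]
  rw [consC, h1]
  simp only [h2]
  have h := sum_contr_curvLin_unit (fderiv ℝ density p.2.1.1 (symUnit μ ν)) (jetConn p.2.2)
  have h3 : ∀ α β γ μ, jetConn p.2.2 μ α β γ = dgam p α β γ μ := fun _ _ _ _ => rfl
  simp only [h3] at h
  have h4 : ricci p = curvLin (jetConn p.2.2) + curvQuad p.2.1.2 := by
    ext α β
    exact ricci_eq p α β
  rw [h, h4, map_add]
  ring

theorem symUnit_comm (μ ν : Fin 4) : symUnit μ ν = symUnit ν μ := by
  ext α β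
  exact if_congr or_comm rfl rfl

theorem consC_comm (μ ν : Fin 4) : consC μ ν = consC ν μ := by
  ext p
  simp only [consC, partialG, symUnit_comm μ ν]

theorem differentiableAt_consC {p : JPt} (hp : p ∈ regular) (μ ν : Fin 4) :
    DifferentiableAt ℝ (consC μ ν) p := by
  have h : consC μ ν =ᶠ[nhds p]
      fun p => -contr (fderiv ℝ density p.2.1.1 (symUnit μ ν)) (ricci p) := by
    filter_upwards [isOpen_regular.mem_nhds hp] with q hq using consC_eq hq μ ν
  refine DifferentiableAt.congr_of_eventuallyEq (DifferentiableAt.neg ?_) h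
  refine ContDiffAt.differentiableAt (n := 1) ?_ one_ne_zero
  refine contDiffAt_contr ?_ fun α β => (contDiff_ricci α β).contDiffAt
  -- The constraint already contains a first derivative of `density`, so two orders of smoothness
  -- are needed.
  have h1 : ContDiffAt ℝ 1 (fderiv ℝ density) p.2.1.1 :=
    (contDiffAt_density (n := 2) hp).fderiv_right (by norm_num)
  have h2 : ContDiffAt ℝ 1 (fun p : JPt => fderiv ℝ density p.2.1.1) p :=
    ContDiffAt.comp (g := fderiv ℝ density) p h1 (by fun_prop)
  exact h2.clm_apply contDiffAt_const

/-! ### Linear forms on symmetric forms -/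

/-- The array with the single component `1` at `(α, β)`. -/
def arrayUnit (α β : Fin 4) : Fin 4 → Fin 4 → ℝ := Pi.single α (Pi.single β 1)

theorem sum_smul_arrayUnit (m : Fin 4 → Fin 4 → ℝ) : ∑ α, ∑ β, m α β • arrayUnit α β = m := by
  ext a b
  simp only [arrayUnit, Finset.sum_apply, Pi.smul_apply, smul_eq_mul]
  simp [Pi.single_apply, ite_apply]

/-- The contraction is a perfect pairing on symmetric forms; the components of `R` are the values of
`l` on symmetrised unit arrays. -/
theorem exists_contr_eq (l : Sym →ₗ[ℝ] ℝ) : ∃ R : Sym, ∀ k, contr k R.1 = l k := by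
  refine ⟨symmetrize fun α β => l (symmetrize (arrayUnit α β)), fun k => ?_⟩
  rw [contr_eq_of_symmetric_part (b' := fun α β => l (symmetrize (arrayUnit α β)))]
  · conv_rhs => rw [← symmetrize_coe k, ← sum_smul_arrayUnit k.1]
    simp only [map_sum, map_smul, smul_eq_mul]
    rfl
  · intro α β
    simp only [symmetrize_apply]
    ring

theorem contr_symmetrize_arrayUnit (b : Fin 4 → Fin 4 → ℝ) (μ ν : Fin 4) :
    contr (symmetrize (arrayUnit μ ν)) b = (b μ ν + b ν μ) / 2 := by
  have h : ∀ α β, (symmetrize (arrayUnit μ ν)).1 α β * b α β =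
      (if α = μ then if β = ν then b α β / 2 else 0 else 0) +
        (if β = μ then if α = ν then b α β / 2 else 0 else 0) := by
    intro α β
    rw [symmetrize_apply]
    simp only [arrayUnit, Pi.single_apply, ite_apply, Pi.zero_apply]
    split_ifs <;> ring
  rw [contr_apply]
  simp only [h, Finset.sum_add_distrib]
  simp
  ring

theorem symUnit_eq (μ ν : Fin 4) :
    symUnit μ ν = (if μ = ν then (1 : ℝ) else 2) • symmetrize (arrayUnit μ ν) := by
  ext α β
  simp only [symUnit, Submodule.coe_smul, Pi.smul_apply, symmetrize_apply, arrayUnit,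
    Pi.single_apply, ite_apply, Pi.zero_apply, smul_eq_mul]
  grind

/-- The contraction `a^{αβ} b_{αβ}` as a linear form in `a`. -/
def contrWith (b : Fin 4 → Fin 4 → ℝ) : Sym →ₗ[ℝ] ℝ where
  toFun a := contr a b
  map_add' a a' := by
    simp only [contr_apply, Submodule.coe_add, Pi.add_apply, add_mul, Finset.sum_add_distrib]
  map_smul' r a := by
    simp only [contr_apply, Submodule.coe_smul, Pi.smul_apply, smul_eq_mul, Finset.mul_sum,
      RingHom.id_apply, mul_assoc]

theorem contrWith_apply (b : Fin 4 → Fin 4 → ℝ) (a : Sym) : contrWith b a = contr a b := rfl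

theorem exists_linear_symUnit (c : Fin 4 → Fin 4 → ℝ) (hc : ∀ μ ν, c μ ν = c ν μ) :
    ∃ l : Sym →ₗ[ℝ] ℝ, ∀ μ ν, l (symUnit μ ν) = c μ ν := by
  -- Off the diagonal `symUnit` has two unit entries, and both contribute to the contraction; hence
  -- the factor one half.
  refine ⟨contrWith fun α β => if α = β then c α β else c α β / 2, fun μ ν => ?_⟩
  rw [symUnit_eq, map_smul, contrWith_apply, contr_symmetrize_arrayUnit, hc ν μ, smul_eq_mul]
  grind

/-- The symmetric part of the Ricci tensor can be prescribed through its contractions with the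
derivatives of the metric density. -/
theorem exists_contr_fderiv_density {g : Sym} (hg : (Matrix.of g.1).det ≠ 0)
    (c : Fin 4 → Fin 4 → ℝ) (hc : ∀ μ ν, c μ ν = c ν μ) :
    ∃ R : Sym, ∀ μ ν, contr (fderiv ℝ density g (symUnit μ ν)) R.1 = c μ ν := by
  obtain ⟨l, hl⟩ := exists_linear_symUnit c hc
  -- The differential of `density` at `density g` inverts the one at `g`, so composing `l` with it
  -- undoes the differential in the goal.
  obtain ⟨R, hR⟩ := exists_contr_eq (l ∘ₗ (fderiv ℝ density (density g)).toLinearMap)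
  refine ⟨R, fun μ ν => ?_⟩
  rw [hR, ← hl μ ν]
  exact congrArg l (fderiv_density_fderiv_density hg _)

/-! ### Solving for the derivatives of the connection -/

/-- The part of the integrability constraints that is linear in the derivatives of the
connection. -/
def intLin (g : Sym) (D : Fin 4 → Conn) (ρ σ μ ν : Fin 4) : ℝ :=
  (∑ l, g.1 ρ l * (D ν l μ σ - D μ l ν σ)) + (∑ l, g.1 σ l * (D ν l μ ρ - D μ l ν ρ))
    + 2 / 3 * g.1 ρ σ * (torsionTrace (D ν) μ - torsionTrace (D μ) ν)

theorem torsion_eq_zero {G : Conn} (hG : ∀ α β γ, G α β γ = G α γ β) (α β γ : Fin 4) :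
    torsion G α β γ = 0 := by
  rw [torsion, hG, sub_self]

theorem torsionTrace_eq_zero {G : Conn} (hG : ∀ α β γ, G α β γ = G α γ β) (γ : Fin 4) :
    torsionTrace G γ = 0 :=
  Finset.sum_eq_zero fun _ _ => torsion_eq_zero hG _ _ _

theorem torsionTrace_add (G G' : Conn) (γ : Fin 4) :
    torsionTrace (G + G') γ = torsionTrace G γ + torsionTrace G' γ := by
  simp only [torsionTrace, torsion, Pi.add_apply, ← Finset.sum_add_distrib]
  exact Finset.sum_congr rfl fun _ _ => by ring

theorem torsionDefect_eq_zero {G : Conn} (hG : ∀ α β γ, G α β γ = G α γ β) (α β γ : Fin 4) :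
    torsionDefect G α β γ = 0 := by
  rw [torsionDefect, torsion_eq_zero hG, torsionTrace_eq_zero hG, torsionTrace_eq_zero hG]
  ring

theorem intLin_of_symmetric (g : Sym) {D : Fin 4 → Conn}
    (hD : ∀ ν α β γ, D ν α β γ = D ν α γ β) {E : Fin 4 → Fin 4 → Fin 4 → Fin 4 → ℝ}
    (hE : ∀ ρ μ σ ν, ∑ l, g.1 ρ l * D ν l μ σ = E ρ μ σ ν) (ρ σ μ ν : Fin 4) :
    intLin g D ρ σ μ ν = E ρ μ σ ν - E ρ ν σ μ + (E σ μ ρ ν - E σ ν ρ μ) := by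
  rw [intLin, torsionTrace_eq_zero (hD _), torsionTrace_eq_zero (hD _)]
  simp only [mul_sub, Finset.sum_sub_distrib, hE]
  ring

theorem lower_raise {g : Sym} (hg : (Matrix.of g.1).det ≠ 0) (E : Fin 4 → ℝ) (ρ : Fin 4) :
    ∑ l, g.1 ρ l * ∑ κ, (Matrix.of g.1)⁻¹ l κ * E κ = E ρ := by
  have h : (Matrix.of g.1).mulVec ((Matrix.of g.1)⁻¹.mulVec E) = E := by
    rw [Matrix.mulVec_mulVec, Matrix.mul_nonsing_inv _ (isUnit_iff_ne_zero.2 hg),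
      Matrix.one_mulVec]
  exact congrFun h ρ

/-- The Koszul trick. The array `E_{ρμσν} = (A_{ρσμν} + A_{ρμσν} - A_{μσρν}) / 4` is symmetric in
`μ, σ` and satisfies `E_{ρμσν} + E_{σμρν} = A_{ρσμν} / 2`; antisymmetrising in `μ, ν` then restores
`A`. -/
theorem exists_symmetric_intLin {g : Sym} (hg : (Matrix.of g.1).det ≠ 0)
    (A : Fin 4 → Fin 4 → Fin 4 → Fin 4 → ℝ) (h1 : ∀ ρ σ μ ν, A ρ σ μ ν = A σ ρ μ ν)
    (h2 : ∀ ρ σ μ ν, A ρ σ μ ν = -A ρ σ ν μ) :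
    ∃ D : Fin 4 → Conn, (∀ ν α β γ, D ν α β γ = D ν α γ β) ∧ intLin g D = A := by
  have hs : ∀ ν α β γ, ∑ κ, (Matrix.of g.1)⁻¹ α κ *
      ((A κ γ β ν + A κ β γ ν - A β γ κ ν) / 4) = ∑ κ, (Matrix.of g.1)⁻¹ α κ *
      ((A κ β γ ν + A κ γ β ν - A γ β κ ν) / 4) := fun ν α β γ => by
    refine Finset.sum_congr rfl fun κ _ => ?_
    rw [h1 γ β κ ν]
    ring
  refine ⟨fun ν l μ σ => ∑ κ, (Matrix.of g.1)⁻¹ l κ *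
    ((A κ σ μ ν + A κ μ σ ν - A μ σ κ ν) / 4), hs, ?_⟩
  ext ρ σ μ ν
  rw [intLin_of_symmetric g hs (fun ρ μ σ ν => lower_raise hg _ ρ)]
  rw [h1 σ ρ, h1 σ μ, h1 μ ρ, h1 σ ρ, h1 σ ν, h1 ν ρ, h2 ρ σ ν μ]
  ring

/-- The solution imitates the second derivatives of a conformal factor. The corresponding metric
derivatives are `g_{ρσ} S_{μν}` with `S` symmetric, so integrability is unaffected, while the Ricci
part is `-S - (tr S) g / 2`. -/
theorem exists_symmetric_curvLin {g : Sym} (hg : (Matrix.of g.1).det ≠ 0) (R : Sym) :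
    ∃ D : Fin 4 → Conn, (∀ ν α β γ, D ν α β γ = D ν α γ β) ∧ intLin g D = 0 ∧
      curvLin D = R.1 := by
  set r : ℝ := ∑ γ, ∑ κ, (Matrix.of g.1)⁻¹ γ κ * R.1 κ γ with hr
  -- Solves `-S - (tr S) g / 2 = R`: in dimension four `tr S = -r + 4r/6 = -r/3`. It is minus twice
  -- the Schouten tensor built from `R`.
  set S : Fin 4 → Fin 4 → ℝ := fun α β => -R.1 α β + r / 6 * g.1 α β with hS
  have hSs : ∀ α β, S α β = S β α := fun α β => by simp only [hS, R.2 α β, g.2 α β]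
  have hinv : ∀ α β, ∑ κ, (Matrix.of g.1)⁻¹ α κ * g.1 κ β = delta α β := fun α β => by
    have h := congrFun (congrFun (Matrix.nonsing_inv_mul _ (isUnit_iff_ne_zero.2 hg)) α) β
    rw [Matrix.mul_apply] at h
    rw [delta, ← Matrix.one_apply]
    exact h
  have htr : ∑ γ, ∑ κ, (Matrix.of g.1)⁻¹ γ κ * S κ γ = -r / 3 := by
    have h : ∀ γ, ∑ κ, (Matrix.of g.1)⁻¹ γ κ * S κ γ =
        -(∑ κ, (Matrix.of g.1)⁻¹ γ κ * R.1 κ γ) + r / 6 * delta γ γ := fun γ => by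
      rw [← hinv, Finset.mul_sum, ← Finset.sum_neg_distrib, ← Finset.sum_add_distrib]
      exact Finset.sum_congr rfl fun κ _ => by rw [hS]; ring
    simp only [h, Finset.sum_add_distrib, Finset.sum_neg_distrib, ← hr, delta, if_true]
    simp
    ring
  set D : Fin 4 → Conn := fun ν l μ σ => (delta l σ * S μ ν + delta l μ * S σ ν -
    g.1 μ σ * ∑ κ, (Matrix.of g.1)⁻¹ l κ * S κ ν) / 2 with hD
  have hDs : ∀ ν α β γ, D ν α β γ = D ν α γ β := fun ν α β γ => by
    simp only [hD]
    rw [g.2 β γ]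
    ring
  refine ⟨D, hDs, ?_, ?_⟩
  · have hE : ∀ ρ μ σ ν, ∑ l, g.1 ρ l * D ν l μ σ =
        (g.1 ρ σ * S μ ν + g.1 ρ μ * S σ ν - g.1 μ σ * S ρ ν) / 2 := by
      intro ρ μ σ ν
      have h : ∀ l, g.1 ρ l * D ν l μ σ = (g.1 ρ l * delta l σ) * (S μ ν / 2) +
          (g.1 ρ l * delta l μ) * (S σ ν / 2) -
          g.1 μ σ / 2 * (g.1 ρ l * ∑ κ, (Matrix.of g.1)⁻¹ l κ * S κ ν) := fun l => by
        rw [hD]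
        ring
      simp only [h, Finset.sum_add_distrib, Finset.sum_sub_distrib, ← Finset.sum_mul,
        ← Finset.mul_sum, lower_raise hg fun κ => S κ ν]
      simp [delta]
      ring
    ext ρ σ μ ν
    rw [intLin_of_symmetric g hDs hE, hSs ν μ, g.2 σ ρ, g.2 μ σ, g.2 ν σ, g.2 ν ρ, g.2 μ ρ]
    simp only [Pi.zero_apply]
    ring
  · ext α β
    have h1 : ∑ γ, D γ γ β α = S α β + g.1 α β * r / 6 := by
      have h : ∀ γ, D γ γ β α = (delta γ α * S β γ + delta γ β * S α γ) / 2 -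
          g.1 β α / 2 * ∑ κ, (Matrix.of g.1)⁻¹ γ κ * S κ γ := fun γ => by
        rw [hD]
        ring
      simp only [h, Finset.sum_sub_distrib, ← Finset.mul_sum, htr, ← Finset.sum_div,
        Finset.sum_add_distrib]
      simp only [delta, ite_mul, one_mul, zero_mul, Finset.sum_ite_eq', Finset.mem_univ, if_true]
      rw [hSs β α, g.2 β α]
      ring
    have h2 : ∑ γ, D β γ γ α = 2 * S α β := by
      have h : ∀ γ, D β γ γ α = (delta γ α * S γ β + delta γ γ * S α β) / 2 -
          1 / 2 * (g.1 α γ * ∑ κ, (Matrix.of g.1)⁻¹ γ κ * S κ β) := fun γ => by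
        rw [g.2 α γ, hD]
        ring
      simp only [h, Finset.sum_sub_distrib, ← Finset.mul_sum, lower_raise hg fun κ => S κ β,
        ← Finset.sum_div, Finset.sum_add_distrib]
      simp [delta]
      ring
    rw [curvLin_apply, h1, h2, hS]
    ring

theorem intLin_add (g : Sym) (D D' : Fin 4 → Conn) :
    intLin g (D + D') = intLin g D + intLin g D' := by
  ext ρ σ μ ν
  simp only [intLin, torsionTrace, torsion, Pi.add_apply, Fin.sum_univ_four]
  ring

/-- The system is triangular: once the integrability part is solved, the Ricci part is corrected by
an array that does not disturb it. -/
theorem exists_symmetric_conn {g : Sym} (hg : (Matrix.of g.1).det ≠ 0)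
    (A : Fin 4 → Fin 4 → Fin 4 → Fin 4 → ℝ) (h1 : ∀ ρ σ μ ν, A ρ σ μ ν = A σ ρ μ ν)
    (h2 : ∀ ρ σ μ ν, A ρ σ μ ν = -A ρ σ ν μ) (c : Fin 4 → Fin 4 → ℝ)
    (hc : ∀ μ ν, c μ ν = c ν μ) :
    ∃ D : Fin 4 → Conn, (∀ ν α β γ, D ν α β γ = D ν α γ β) ∧ intLin g D = A ∧
      ∀ μ ν, contr (fderiv ℝ density g (symUnit μ ν)) (curvLin D) = c μ ν := by
  obtain ⟨D, hD, hDA⟩ := exists_symmetric_intLin hg A h1 h2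
  obtain ⟨R, hR⟩ := exists_contr_fderiv_density hg
    (fun μ ν => c μ ν - contr (fderiv ℝ density g (symUnit μ ν)) (curvLin D))
    fun μ ν => by rw [hc, symUnit_comm]
  obtain ⟨D', hD', hD0, hDR⟩ := exists_symmetric_curvLin hg R
  refine ⟨D + D', fun ν α β γ => ?_, ?_, fun μ ν => ?_⟩
  · simp only [Pi.add_apply, hD ν α β γ, hD' ν α β γ]
  · rw [intLin_add, hDA, hD0, add_zero]
  · rw [map_add, map_add, hDR, hR]
    ring

/-! ### The constraints along the fibres of `J¹π → E` -/

theorem consM_add (x : Base) (y : Fib) (v w : Fin 4 → Fib) (ρ σ μ : Fin 4) :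
    consM ρ σ μ (x, y, v + w) = consM ρ σ μ (x, y, v) + (w μ).1.1 ρ σ := by
  simp only [consM, dmetric, metric, gam, Pi.add_apply, Prod.fst_add, Submodule.coe_add]
  ring

theorem consI_add (x : Base) (y : Fib) (v w : Fin 4 → Fib) (ρ σ μ ν : Fin 4) :
    consI ρ σ μ ν (x, y, v + w) =
      consI ρ σ μ ν (x, y, v) + intLin y.1 (jetConn w) ρ σ μ ν := by
  have h : ∀ ρ σ μ ν, ∑ l, metric (x, y, v + w) ρ l * (dgam (x, y, v + w) l μ σ ν -
      dgam (x, y, v + w) l ν σ μ) = (∑ l, metric (x, y, v) ρ l * (dgam (x, y, v) l μ σ ν -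
      dgam (x, y, v) l ν σ μ)) +
      ∑ l, y.1.1 ρ l * (jetConn w ν l μ σ - jetConn w μ l ν σ) := fun ρ σ μ ν => by
    rw [← Finset.sum_add_distrib]
    refine Finset.sum_congr rfl fun l _ => ?_
    simp only [metric, dgam, jetConn, Pi.add_apply, Prod.snd_add]
    ring
  have h2 : ∀ μ ν, torsionTrace ((v + w) ν).2 μ = torsionTrace (v ν).2 μ +
      torsionTrace (jetConn w ν) μ := fun μ ν => by
    exact torsionTrace_add _ _ _
  rw [consI, h, h]
  simp only [h2]
  rw [consI, intLin]
  simp only [metric, gam]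
  ring

theorem torsionDefect_add (G G' : Conn) (α β γ : Fin 4) :
    torsionDefect (G + G') α β γ = torsionDefect G α β γ + torsionDefect G' α β γ := by
  simp only [torsionDefect, torsionTrace, torsion, Pi.add_apply, Fin.sum_univ_four]
  ring

theorem torsionDefect_smul (t : ℝ) (G : Conn) (α β γ : Fin 4) :
    torsionDefect (t • G) α β γ = t * torsionDefect G α β γ := by
  simp only [torsionDefect, torsionTrace, torsion, Pi.smul_apply, smul_eq_mul, Fin.sum_univ_four]
  ring

theorem consR_add (x : Base) (y : Fib) (v w : Fin 4 → Fib) (α β γ ν : Fin 4) :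
    consR α β γ ν (x, y, v + w) =
      consR α β γ ν (x, y, v) + torsionDefect (w ν).2 α β γ :=
  torsionDefect_add _ _ _ _ _

theorem consC_add {x : Base} {y : Fib} (hy : (Matrix.of y.1.1).det ≠ 0) (v w : Fin 4 → Fib)
    (μ ν : Fin 4) : consC μ ν (x, y, v + w) = consC μ ν (x, y, v) -
      contr (fderiv ℝ density y.1 (symUnit μ ν)) (curvLin (jetConn w)) := by
  rw [consC_eq (show (x, y, v + w) ∈ regular from hy), consC_eq (show (x, y, v) ∈ regular from hy)]
  have h : ricci (x, y, v + w) = ricci (x, y, v) + curvLin (jetConn w) := by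
    ext α β
    have : jetConn (v + w) = jetConn v + jetConn w := rfl
    simp only [ricci_eq, Pi.add_apply, this, map_add]
    ring
  simp only [h, map_add]
  ring

/-! ### Symmetries and smoothness of the constraint functions. -/

theorem consM_comm (ρ σ μ : Fin 4) : consM ρ σ μ = consM σ ρ μ := by
  ext p
  have h : ∀ q : Sym, q.1 ρ σ = q.1 σ ρ := fun q => q.2 ρ σ
  simp only [consM, dmetric, metric, h]
  ring

theorem consI_comm (ρ σ μ ν : Fin 4) : consI ρ σ μ ν = consI σ ρ μ ν := by
  ext p
  have h : ∀ q : Sym, q.1 ρ σ = q.1 σ ρ := fun q => q.2 ρ σ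
  simp only [consI, metric, h]
  ring

theorem consI_swap (ρ σ μ ν : Fin 4) : consI ρ σ μ ν = -consI ρ σ ν μ := by
  ext p
  simp only [Pi.neg_apply, consI, mul_sub, Finset.sum_sub_distrib]
  ring

theorem contDiff_consM {n : ℕ∞ω} (ρ σ μ : Fin 4) : ContDiff ℝ n (consM ρ σ μ) := by
  have := contDiff_dmetric (n := n) ρ σ μ
  unfold consM torsionTrace torsion
  fun_prop

theorem contDiff_consT {n : ℕ∞ω} (α β γ : Fin 4) : ContDiff ℝ n (consT α β γ) := by
  unfold consT torsionDefect torsionTrace torsion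
  fun_prop

theorem contDiff_consR {n : ℕ∞ω} (α β γ ν : Fin 4) : ContDiff ℝ n (consR α β γ ν) := by
  unfold consR torsionDefect torsionTrace torsion
  fun_prop

theorem contDiff_consI {n : ℕ∞ω} (ρ σ μ ν : Fin 4) : ContDiff ℝ n (consI ρ σ μ ν) := by
  unfold consI torsionTrace torsion
  fun_prop

/-- The differential of a function that is affine along the fibres of `J¹π → E`. -/
theorem fderiv_of_jet_affine {φ : JPt → ℝ} {p : JPt} (hφ : DifferentiableAt ℝ φ p)
    {l : (Fin 4 → Fib) → ℝ} (hl : ∀ (t : ℝ) w, l (t • w) = t * l w)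
    (h : ∀ w, φ (p.1, p.2.1, p.2.2 + w) = φ p + l w) (x : Base) (y : Fib) (w : Fin 4 → Fib) :
    fderiv ℝ φ p (x, y, w) = fderiv ℝ φ p (x, y, 0) + l w := by
  have h1 : fderiv ℝ φ p (0, 0, w) = l w := by
    refine fderiv_apply_of_line (b := 0) hφ fun t => ?_
    rw [show p + t • ((0, 0, w) : JPt) = (p.1, p.2.1, p.2.2 + t • w) by
      ext <;> simp, h, hl]
    simp
  rw [← h1, ← map_add]
  simp

theorem constraints_forall {P : (JPt → ℝ) → Prop} :
    (∀ φ ∈ constraints, P φ) ↔ (∀ μ ν, P (consC μ ν)) ∧ (∀ ρ σ μ, P (consM ρ σ μ)) ∧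
      (∀ α β γ, P (consT α β γ)) ∧ (∀ α β γ ν, P (consR α β γ ν)) ∧
        ∀ ρ σ μ ν, P (consI ρ σ μ ν) := by
  constructor
  · intro h
    refine ⟨fun μ ν => h _ (Or.inl ⟨μ, ν, rfl⟩), fun ρ σ μ => h _ (Or.inr (Or.inl ⟨ρ, σ, μ, rfl⟩)),
      fun α β γ => h _ (Or.inr (Or.inr (Or.inl ⟨α, β, γ, rfl⟩))),
      fun α β γ ν => h _ (Or.inr (Or.inr (Or.inr (Or.inl ⟨α, β, γ, ν, rfl⟩)))),
      fun ρ σ μ ν => h _ (Or.inr (Or.inr (Or.inr (Or.inr ⟨ρ, σ, μ, ν, rfl⟩))))⟩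
  · rintro ⟨h1, h2, h3, h4, h5⟩ φ (⟨μ, ν, rfl⟩ | ⟨ρ, σ, μ, rfl⟩ | ⟨α, β, γ, rfl⟩ |
      ⟨α, β, γ, ν, rfl⟩ | ⟨ρ, σ, μ, ν, rfl⟩)
    exacts [h1 _ _, h2 _ _ _, h3 _ _ _, h4 _ _ _ _, h5 _ _ _ _]

theorem torsionTrace_smul (t : ℝ) (G : Conn) (γ : Fin 4) :
    torsionTrace (t • G) γ = t * torsionTrace G γ := by
  simp only [torsionTrace, torsion, Pi.smul_apply, smul_eq_mul, Finset.mul_sum, mul_sub]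

theorem intLin_smul (g : Sym) (t : ℝ) (D : Fin 4 → Conn) (ρ σ μ ν : Fin 4) :
    intLin g (t • D) ρ σ μ ν = t * intLin g D ρ σ μ ν := by
  simp only [intLin, Pi.smul_apply, torsionTrace_smul, smul_eq_mul, mul_add, Finset.mul_sum]
  congr 1
  · congr 1 <;> exact Finset.sum_congr rfl fun l _ => by ring
  · ring

/-- Every vector of `E` that is tangent to the locus `t = 0` is the projection of a vector tangent
to `S_f`. -/
theorem exists_isTangent {p : JPt} (hp : p ∈ regular) (x : Base) (k : Sym) {f : Conn}
    (hf : ∀ α β γ, torsionDefect f α β γ = 0) :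
    ∃ w : Fin 4 → Fib, IsTangent p (x, (k, f), w) := by
  have hM : ∀ ρ σ μ w, fderiv ℝ (consM ρ σ μ) p (x, (k, f), w) = _ := fun ρ σ μ w =>
    fderiv_of_jet_affine (l := fun w => (w μ).1.1 ρ σ)
      ((contDiff_consM (n := 1) ρ σ μ).contDiffAt.differentiableAt one_ne_zero)
      (fun t w => rfl) (fun w => consM_add _ _ _ _ _ _ _) x (k, f) w
  have hI : ∀ ρ σ μ ν w, fderiv ℝ (consI ρ σ μ ν) p (x, (k, f), w) = _ := fun ρ σ μ ν w =>
    fderiv_of_jet_affine (l := fun w => intLin p.2.1.1 (jetConn w) ρ σ μ ν)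
      ((contDiff_consI (n := 1) ρ σ μ ν).contDiffAt.differentiableAt one_ne_zero)
      (fun t w => intLin_smul _ _ _ _ _ _ _) (fun w => consI_add _ _ _ _ _ _ _ _) x (k, f) w
  have hR : ∀ α β γ ν w, fderiv ℝ (consR α β γ ν) p (x, (k, f), w) = _ := fun α β γ ν w =>
    fderiv_of_jet_affine (l := fun w => torsionDefect (w ν).2 α β γ)
      ((contDiff_consR (n := 1) α β γ ν).contDiffAt.differentiableAt one_ne_zero)
      (fun t w => torsionDefect_smul _ _ _ _ _) (fun w => consR_add _ _ _ _ _ _ _ _) x (k, f) w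
  have hC : ∀ μ ν w, fderiv ℝ (consC μ ν) p (x, (k, f), w) = _ := fun μ ν w =>
    fderiv_of_jet_affine (l := fun w => -contr (fderiv ℝ density p.2.1.1 (symUnit μ ν))
        (curvLin (jetConn w)))
      (differentiableAt_consC hp μ ν)
      (fun t w => by
        rw [show jetConn (t • w) = t • jetConn w from rfl, map_smul, map_smul, smul_eq_mul]
        ring)
      (fun w => by rw [consC_add hp, sub_eq_add_neg]) x (k, f) w
  -- The derivatives of `Γ` in the lift cancel what `(x, k, f)` alone contributes to the
  -- differentials of `i` and `c`. The sign is opposite for `c`, whose linear part carries a minus;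
  -- symmetry of `D` takes care of `r`.
  obtain ⟨D, hD, hDI, hDC⟩ := exists_symmetric_conn hp
    (fun ρ σ μ ν => -fderiv ℝ (consI ρ σ μ ν) p (x, (k, f), 0))
    (fun ρ σ μ ν => by rw [consI_comm])
    (fun ρ σ μ ν => by rw [consI_swap, fderiv_neg, neg_apply])
    (fun μ ν => fderiv ℝ (consC μ ν) p (x, (k, f), 0)) (fun μ ν => by rw [consC_comm])
  refine ⟨fun μ => (⟨fun ρ σ => -fderiv ℝ (consM ρ σ μ) p (x, (k, f), 0), fun ρ σ => by
    beta_reduce; rw [consM_comm]⟩, D μ), constraints_forall.2 ⟨?_, ?_, ?_, ?_, ?_⟩⟩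
  · intro μ ν
    rw [hC]
    exact (congrArg (fun c => fderiv ℝ (consC μ ν) p (x, (k, f), 0) + -c) (hDC μ ν)).trans
      (add_neg_cancel _)
  · intro ρ σ μ
    rw [hM]
    exact add_neg_cancel _
  · intro α β γ
    refine fderiv_apply_eq_zero_of_line fun t => ?_
    change torsionDefect (p.2.1.2 + t • f) α β γ = torsionDefect p.2.1.2 α β γ
    rw [torsionDefect_add, torsionDefect_smul, hf, mul_zero, add_zero]
  · intro α β γ ν
    rw [hR]
    have h0 : fderiv ℝ (consR α β γ ν) p (x, (k, f), 0) = 0 :=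
      fderiv_apply_eq_zero_of_line fun t => by simp [consR]
    rw [h0, zero_add]
    exact torsionDefect_eq_zero (hD ν) _ _ _
  · intro ρ σ μ ν
    rw [hI]
    have := congrFun (congrFun (congrFun (congrFun hDI ρ) σ) μ) ν
    exact (congrArg (fun c => fderiv ℝ (consI ρ σ μ ν) p (x, (k, f), 0) + c) this).trans
      (add_neg_cancel _)

/-- The projection of `S_f` to `E` is the locus `t = 0`. -/
theorem exists_mem_finalSet {U : Set Base} {q : EPt} (hq : q ∈ eDom U)
    (ht : ∀ α β γ, torsionDefect q.2.2 α β γ = 0) :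
    ∃ v : Fin 4 → Fib, (q.1, q.2, v) ∈ finalSet U := by
  have hr : (Matrix.of q.2.1.1).det ≠ 0 := IsLorentzian.det_ne_zero hq.2
  obtain ⟨D, hD, hDI, hDC⟩ := exists_symmetric_conn hr
    (fun ρ σ μ ν => -consI ρ σ μ ν (q.1, q.2, 0))
    (fun ρ σ μ ν => by rw [consI_comm])
    (fun ρ σ μ ν => by rw [consI_swap, Pi.neg_apply])
    (fun μ ν => consC μ ν (q.1, q.2, 0)) (fun μ ν => by rw [consC_comm])
  -- Each constraint is affine on the fibre, so its value at the zero jet is the inhomogeneous term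
  -- to be cancelled.
  set v : Fin 4 → Fib := fun μ => (⟨fun ρ σ => -consM ρ σ μ (q.1, q.2, 0), fun ρ σ => by
    beta_reduce; rw [consM_comm]⟩, D μ) with hv
  refine ⟨v, hq, constraints_forall.2 ⟨?_, ?_, ht, ?_, ?_⟩⟩
  · intro μ ν
    rw [← zero_add v, consC_add hr]
    exact (congrArg (fun c => consC μ ν (q.1, q.2, 0) - c) (hDC μ ν)).trans (sub_self _)
  · intro ρ σ μ
    rw [← zero_add v, consM_add]
    exact add_neg_cancel _
  · intro α β γ ν
    exact torsionDefect_eq_zero (hD ν) _ _ _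
  · intro ρ σ μ ν
    rw [← zero_add v, consI_add]
    have := congrFun (congrFun (congrFun (congrFun hDI ρ) σ) μ) ν
    exact (congrArg (fun c => consI ρ σ μ ν (q.1, q.2, 0) + c) this).trans (add_neg_cancel _)

/-! ### The Poincaré-Cartan form -/

/-- The matrix of the `x`-components of four vectors. -/
def baseMatrix (w : Fin 4 → JPt) : Matrix (Fin 4) (Fin 4) ℝ := Matrix.of fun i => (w i).1

theorem wedge_dx_apply (w : Fin 4 → JPt) : wedge dx w = (baseMatrix w).det := rfl

/-- Replacing the factor `dx^μ` by `θ` replaces column `μ` of the matrix of base components, as in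
Cramer's rule. -/
theorem wedge3_apply (θ : JPt →L[ℝ] ℝ) (μ : Fin 4) (w : Fin 4 → JPt) :
    wedge3 θ μ w = (baseMatrix w).cramer (fun i => θ (w i)) μ := by
  rw [Matrix.cramer_apply]
  change Matrix.det (Matrix.of fun i j => Function.update dx μ θ j (w i)) = _
  congr 1
  ext i j
  rw [Matrix.updateCol_apply]
  split_ifs with h
  · subst h
    simp
  · simp [Function.update_of_ne h, baseMatrix, dx]

/-- `wedge3` as a continuous linear map. -/
def wedge3L (μ : Fin 4) : (JPt →L[ℝ] ℝ) →L[ℝ] (JPt [⋀^Fin 4]→L[ℝ] ℝ) :=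
  LinearMap.toContinuousLinearMap
    { toFun := fun θ => wedge3 θ μ
      map_add' := fun θ θ' => by
        ext w
        rw [ContinuousAlternatingMap.add_apply]
        simp only [wedge3_apply]
        rw [← Pi.add_apply, ← map_add]
        rfl
      map_smul' := fun c θ => by
        ext w
        rw [ContinuousAlternatingMap.smul_apply]
        simp only [wedge3_apply]
        rw [RingHom.id_apply, ← Pi.smul_apply, ← map_smul]
        rfl }

theorem differentiableAt_sum_alternating {E : Type*} [NormedAddCommGroup E] [NormedSpace ℝ E]
    {n : ℕ} {ι : Type*} [Fintype ι] {p : E} {f : ι → E → E →L[ℝ] ℝ}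
    (l : ι → (E →L[ℝ] ℝ) →L[ℝ] E [⋀^Fin n]→L[ℝ] ℝ) (hf : ∀ i, DifferentiableAt ℝ (f i) p)
    {c : E → ℝ} (hc : DifferentiableAt ℝ c p) (η : E [⋀^Fin n]→L[ℝ] ℝ) :
    DifferentiableAt ℝ (fun q => (∑ i, l i (f i q)) - c q • η) p :=
  (DifferentiableAt.fun_sum fun i _ => (l i).differentiableAt.comp p (hf i)).sub
    (hc.smul_const η)

theorem differentiableAt_momentum {p : JPt} (hp : p ∈ regular) (μ : Fin 4) :
    DifferentiableAt ℝ (momentum lagrangian μ) p := by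
  have h : ContDiffAt ℝ 1 (fderiv ℝ lagrangian) p :=
    (contDiffAt_lagrangian (n := 2) hp).fderiv_right (by norm_num)
  exact (h.differentiableAt one_ne_zero).clm_comp (differentiableAt_const _)

theorem differentiableAt_energy {p : JPt} (hp : p ∈ regular) :
    DifferentiableAt ℝ (energy lagrangian) p := by
  refine DifferentiableAt.sub (DifferentiableAt.fun_sum fun μ _ => ?_)
    ((contDiffAt_lagrangian (n := 1) hp).differentiableAt one_ne_zero)
  exact (differentiableAt_momentum hp μ).clm_apply (by fun_prop)

theorem differentiableAt_poincareCartan {p : JPt} (hp : p ∈ regular) :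
    DifferentiableAt ℝ (poincareCartan lagrangian) p := by
  exact differentiableAt_sum_alternating wedge3L (fun μ =>
    (differentiableAt_momentum hp μ).clm_comp (differentiableAt_const dy))
    (differentiableAt_energy hp) (wedge dx)

/-- `a^{αβ}` contracted with the momentum structure: for `a = √|det g| g^{αβ}` this is
`(∂L/∂Γ^α_{βγ,μ}) f^α_{βγ}`. -/
def mom (a : Sym) (μ : Fin 4) (f : Conn) : ℝ := contr a (curvLin (Pi.single μ f))

theorem poincareCartan_apply {p : JPt} (hp : p ∈ regular) (w : Fin 4 → JPt) :
    poincareCartan lagrangian p w =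
      (∑ μ, (baseMatrix w).cramer (fun i => mom (density p.2.1.1) μ (w i).2.1.2) μ) -
        energy lagrangian p * (baseMatrix w).det := by
  rw [poincareCartan, ContinuousAlternatingMap.sub_apply, ContinuousAlternatingMap.sum_apply,
    ContinuousAlternatingMap.smul_apply, wedge_dx_apply, smul_eq_mul]
  congr 1
  refine Finset.sum_congr rfl fun μ _ => ?_
  rw [wedge3_apply]
  refine congrArg (fun b => (baseMatrix w).cramer b μ) (funext fun i => ?_)
  rw [mom, ContinuousLinearMap.comp_apply, momentum_lagrangian hp]
  rfl

/-- On fixed vectors `w`, `Θ` depends on the point only through the metric density and the energy.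
-/
theorem fderiv_poincareCartan_apply {p : JPt} (hp : p ∈ regular) (w : Fin 4 → JPt) (u : JPt) :
    fderiv ℝ (fun q => poincareCartan lagrangian q w) p u =
      (∑ μ, (baseMatrix w).cramer
        (fun i => mom (fderiv ℝ density p.2.1.1 u.2.1.1) μ (w i).2.1.2) μ) -
        fderiv ℝ (energy lagrangian) p u * (baseMatrix w).det := by
  have h1 : ∀ μ i, HasFDerivAt (fun q : JPt => mom (density q.2.1.1) μ (w i).2.1.2)
      (fderiv ℝ (fun q : JPt => mom (density q.2.1.1) μ (w i).2.1.2) p) p := fun μ i =>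
    ((contDiffAt_contr (c := fun _ => curvLin (Pi.single μ (w i).2.1.2))
      (contDiffAt_density_comp (n := 1) hp) fun _ _ =>
      contDiffAt_const).differentiableAt one_ne_zero).hasFDerivAt
  have h2 : ∀ μ i, fderiv ℝ (fun q : JPt => mom (density q.2.1.1) μ (w i).2.1.2) p u =
      mom (fderiv ℝ density p.2.1.1 u.2.1.1) μ (w i).2.1.2 := fun μ i => by
    have h := fderiv_contr_density (c := fun _ => curvLin (Pi.single μ (w i).2.1.2)) hp
      (fun _ _ => differentiableAt_const _) u
    have hz : contr (density p.2.1.1) (fun _ _ => 0) = 0 := map_zero _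
    simp only [fderiv_fun_const, Pi.zero_apply, zero_apply, hz, add_zero] at h
    exact h
  have h3 : ∀ μ, HasFDerivAt (fun q : JPt => (baseMatrix w).cramer
      (fun i => mom (density q.2.1.1) μ (w i).2.1.2) μ)
      (((ContinuousLinearMap.proj (R := ℝ) (φ := fun _ : Fin 4 => ℝ) μ).comp
        (LinearMap.toContinuousLinearMap (baseMatrix w).cramer)).comp
        (ContinuousLinearMap.pi fun i =>
          fderiv ℝ (fun q : JPt => mom (density q.2.1.1) μ (w i).2.1.2) p)) p := fun μ =>
    (((ContinuousLinearMap.proj (R := ℝ) (φ := fun _ : Fin 4 => ℝ) μ).comp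
      (LinearMap.toContinuousLinearMap (baseMatrix w).cramer)).hasFDerivAt).comp p
      (hasFDerivAt_pi.2 fun i => h1 μ i)
  have h4 := (HasFDerivAt.fun_sum (u := Finset.univ) fun μ _ => h3 μ).fun_sub
    ((differentiableAt_energy hp).hasFDerivAt.mul_const (baseMatrix w).det)
  have h5 : (fun q => poincareCartan lagrangian q w) =ᶠ[nhds p] fun q =>
      (∑ μ, (baseMatrix w).cramer (fun i => mom (density q.2.1.1) μ (w i).2.1.2) μ) -
        energy lagrangian q * (baseMatrix w).det := by
    filter_upwards [isOpen_regular.mem_nhds hp] with q hq using poincareCartan_apply hq w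
  rw [h5.fderiv_eq, h4.fderiv, sub_apply, sum_apply, smul_apply, smul_eq_mul,
    mul_comm (baseMatrix w).det]
  congr 1
  refine Finset.sum_congr rfl fun μ _ => ?_
  have h6 : (fun i => mom (fderiv ℝ density p.2.1.1 u.2.1.1) μ (w i).2.1.2) =
      fun i => fderiv ℝ (fun q : JPt => mom (density q.2.1.1) μ (w i).2.1.2) p u :=
    funext fun i => (h2 μ i).symm
  rw [h6]
  rfl

theorem baseMatrix_cons_det {u : JPt} (hu : u.1 = 0) (w : Fin 3 → JPt) :
    (baseMatrix (Matrix.vecCons u w)).det = 0 :=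
  Matrix.det_eq_zero_of_row_eq_zero 0 fun j => by simp [baseMatrix, hu]

/-- Verticality of `u` makes the first row zero outside the replaced column `μ`, so Laplace
expansion along it leaves a single minor, the one that also occurs in `cramer_eq_sum`. -/
theorem baseMatrix_cons_cramer {u : JPt} (hu : u.1 = 0) (w : Fin 4 → JPt) (j μ : Fin 4)
    (b : Fin 4 → ℝ) :
    (baseMatrix (Matrix.vecCons u (j.removeNth w))).cramer b μ =
      (-1) ^ (μ : ℕ) * b 0 *
        ((baseMatrix w).submatrix j.succAbove μ.succAbove).det := by
  rw [Matrix.cramer_apply, Matrix.det_succ_row_zero, Finset.sum_eq_single μ]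
  · rw [Matrix.updateCol_self]
    congr 2
    ext i k
    simp [baseMatrix, Fin.removeNth]
  · intro k _ hk
    rw [Matrix.updateCol_ne hk]
    simp [baseMatrix, hu]
  · simp

theorem cramer_eq_sum (X : Matrix (Fin 4) (Fin 4) ℝ) (b : Fin 4 → ℝ) (μ : Fin 4) :
    X.cramer b μ = ∑ j : Fin 4, (-1) ^ (j + μ : ℕ) * b j *
      (X.submatrix j.succAbove μ.succAbove).det := by
  rw [Matrix.cramer_apply, Matrix.det_succ_column _ μ]
  refine Finset.sum_congr rfl fun j _ => ?_
  rw [Matrix.updateCol_self]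
  congr 2
  ext i k
  simp

/-- The contraction of `Ω` with a vertical vector. -/
theorem omega_vertical {p : JPt} (hp : p ∈ regular) {u : JPt} (hu : u.1 = 0) (w : Fin 4 → JPt) :
    omega p (Matrix.vecCons u w) =
      (∑ μ, (baseMatrix w).cramer
        (fun i => mom (fderiv ℝ density p.2.1.1 (w i).2.1.1) μ u.2.1.2) μ) -
      (∑ μ, (baseMatrix w).cramer
        (fun i => mom (fderiv ℝ density p.2.1.1 u.2.1.1) μ (w i).2.1.2) μ) +
      fderiv ℝ (energy lagrangian) p u * (baseMatrix w).det := by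
  rw [omega, ContinuousAlternatingMap.neg_apply,
    extDeriv_apply (differentiableAt_poincareCartan hp), Fin.sum_univ_succ]
  have h0 : (0 : Fin 5).removeNth (Matrix.vecCons u w) = w := rfl
  have hs : ∀ j : Fin 4, j.succ.removeNth (Matrix.vecCons u w) =
      Matrix.vecCons u (j.removeNth w) := fun j => by
    ext i : 1
    refine Fin.cases ?_ (fun i => ?_) i <;> simp [Fin.removeNth]
  simp only [h0, hs, fderiv_poincareCartan_apply hp, baseMatrix_cons_det hu,
    baseMatrix_cons_cramer hu, Matrix.cons_val_zero, Matrix.cons_val_succ]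
  have h1 : ∀ μ, (baseMatrix w).cramer
      (fun i => mom (fderiv ℝ density p.2.1.1 (w i).2.1.1) μ u.2.1.2) μ = _ := fun μ =>
    cramer_eq_sum _ _ μ
  simp only [h1]
  rw [Finset.sum_comm]
  simp only [mul_zero, sub_zero, Fin.val_zero, pow_zero, one_smul, Fin.val_succ]
  -- `A` and `B` come from differentiating along `u`, `S'` from differentiating along the `w j`. As
  -- `w j` sits in slot `j + 1`, the alternating sign is opposite to that of the Laplace expansion
  -- `S`.
  have h2 : ∀ A B S S' : ℝ, S' = -S → -(A - B + S') = S - A + B := fun A B S S' h => by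
    rw [h]; ring
  apply h2
  rw [← Finset.sum_neg_distrib]
  refine Finset.sum_congr rfl fun j _ => ?_
  rw [zsmul_eq_mul, Finset.mul_sum, ← Finset.sum_neg_distrib]
  refine Finset.sum_congr rfl fun μ _ => ?_
  push_cast
  rw [pow_add, pow_succ]
  ring

/-! ### The momentum structure -/

theorem curvLin_single (μ : Fin 4) (f : Conn) (α β : Fin 4) :
    curvLin (Pi.single μ f) α β = f μ β α - delta β μ * ∑ γ, f γ γ α := by
  rw [curvLin_apply]
  congr 1
  · rw [Finset.sum_eq_single μ]
    · simp
    · intro γ _ h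
      simp [h]
    · simp
  · rw [delta, Finset.mul_sum]
    refine Finset.sum_congr rfl fun γ _ => ?_
    split_ifs with h
    · subst h
      simp
    · simp [h]

theorem mom_zero_left (μ : Fin 4) (f : Conn) : mom 0 μ f = 0 := contr_zero_left _

theorem mom_zero_right (a : Sym) (μ : Fin 4) : mom a μ 0 = 0 := by
  rw [mom, Pi.single_zero, map_zero, map_zero]

theorem traceArray_trace (C : Fin 4 → ℝ) (γ : Fin 4) : ∑ ν, traceArray C ν ν γ = C γ := by
  simp [traceArray, delta]

/-- The momentum array of such a field is `C_β δ_{μα} - C_α δ_{βμ} + K^μ_{βα}`, antisymmetric in `α,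
β`, and is contracted with a symmetric `a`. -/
theorem mom_trace_add_torsion (a : Sym) (μ : Fin 4) (C : Fin 4 → ℝ) {K : Conn}
    (hK : IsTorsionType K) : mom a μ (traceArray C + K) = 0 := by
  rw [mom, ← map_zero (contr a)]
  refine contr_eq_of_symmetric_part a fun α β => ?_
  have ht : ∀ α, ∑ γ, (traceArray C + K) γ γ α = C α := fun α => by
    simp only [Pi.add_apply, Finset.sum_add_distrib, traceArray_trace, hK.2, add_zero]
  rw [curvLin_single, curvLin_single, ht, ht]
  simp only [Pi.add_apply, traceArray, Pi.zero_apply, hK.1 μ β α, delta, eq_comm (a := μ)]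
  ring

/-- Testing on symmetric units shows that `f` and the trace array of its own contraction `f^γ_{γα}`
have the same part symmetric in the lower indices. Their difference is thus antisymmetric, and it is
trace-free by the choice of `C`. -/
theorem exists_trace_add_torsion {f : Conn} (hf : ∀ a μ, mom a μ f = 0) :
    ∃ (C : Fin 4 → ℝ) (K : Conn), IsTorsionType K ∧ f = traceArray C + K := by
  set F : Fin 4 → ℝ := fun α => ∑ γ, f γ γ α with hF
  have h : ∀ μ α β, f μ β α - delta β μ * F α + (f μ α β - delta α μ * F β) = 0 := by
    intro μ α β
    have h1 := hf (symmetrize (arrayUnit α β)) μ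
    rw [mom, contr_symmetrize_arrayUnit, curvLin_single, curvLin_single] at h1
    linarith
  refine ⟨F, f - traceArray F, ⟨fun α β γ => ?_, fun γ => ?_⟩, (add_sub_cancel _ _).symm⟩
  · have h1 := h α γ β
    simp only [Pi.sub_apply, traceArray]
    simp only [delta, eq_comm (b := α)] at h1 ⊢
    linarith
  · simp only [Pi.sub_apply, Finset.sum_sub_distrib, traceArray_trace]
    exact sub_self _

theorem contr_comm (a b : Sym) : contr a b.1 = contr b a.1 := by
  simp only [contr_apply, mul_comm]

theorem eq_zero_of_mom {a : Sym}
    (ha : ∀ μ l, (∀ α β γ, torsionDefect l α β γ = 0) → mom a μ l = 0) : a = 0 := by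
  ext α β
  -- With `μ` away from `α, β`, the test array whose only block is `S` in upper index `μ` has
  -- vanishing contraction `l^γ_{γδ} = S_{μδ}`, so its curvature part is `S` itself.
  obtain ⟨μ, hα, hβ⟩ : ∃ μ : Fin 4, μ ≠ α ∧ μ ≠ β := by
    revert α β
    decide
  set S : Sym := symmetrize (arrayUnit α β) with hS
  have hSμ : ∀ γ, S.1 μ γ = 0 := fun γ => by
    rw [hS, symmetrize_apply]
    simp [arrayUnit, hα, hβ, Pi.single_apply, ite_apply]
  have h := ha μ (Pi.single μ S.1) (torsionDefect_eq_zero fun κ β γ => by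
    rcases eq_or_ne κ μ with rfl | h
    · simp only [Pi.single_eq_same]
      exact S.2 β γ
    · simp [h])
  have h2 : contr a (curvLin (Pi.single μ (Pi.single μ S.1))) = contr a S.1 := by
    refine contr_eq_of_symmetric_part a fun κ l => ?_
    have ht : ∀ δ, ∑ γ, (Pi.single μ S.1 : Conn) γ γ δ = 0 := fun δ => by
      refine Finset.sum_eq_zero fun γ _ => ?_
      rcases eq_or_ne γ μ with rfl | h
      · simp [hSμ]
      · simp [h]
    rw [curvLin_single, curvLin_single, ht, ht]
    simp only [Pi.single_eq_same]
    ring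
  rw [mom, h2, contr_comm, hS, contr_symmetrize_arrayUnit, a.2 β α] at h
  simp only [ZeroMemClass.coe_zero, Pi.zero_apply]
  linarith

/-! ### The Hamiltonian along trace and torsion directions -/

/-- Invariance is exact, not merely infinitesimal: the cross terms and the `C_β C_α` terms of the
two products cancel in pairs. -/
theorem curvQuad_add_traceArray (G : Conn) (C : Fin 4 → ℝ) (α β : Fin 4) :
    curvQuad (G + traceArray C) α β = curvQuad G α β := by
  simp only [curvQuad, Pi.add_apply, traceArray, delta, add_mul, mul_add,
    Finset.sum_add_distrib, mul_ite, ite_mul, mul_one, mul_zero, zero_mul,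
    Finset.sum_ite_eq, Finset.sum_ite_eq', Finset.mem_univ, if_true]
  simp [← Finset.mul_sum]

/-- The polarisation of `curvQuad`. -/
def curvBilin (G K : Conn) (α β : Fin 4) : ℝ :=
  (∑ γ, ∑ σ, (G γ β α * K σ σ γ + K γ β α * G σ σ γ)) -
    ∑ γ, ∑ σ, (G γ β σ * K σ γ α + K γ β σ * G σ γ α)

theorem curvQuad_add_smul (G K : Conn) (t : ℝ) (α β : Fin 4) :
    curvQuad (G + t • K) α β =
      curvQuad G α β + t * curvBilin G K α β + t ^ 2 * curvQuad K α β := by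
  simp only [curvQuad, curvBilin, mul_sub, Finset.mul_sum, Pi.add_apply, Pi.smul_apply,
    smul_eq_mul]
  have h : ∀ a b c d e f : ℝ, a - d + (b - e) + (c - f) = (a + b + c) - (d + e + f) := by
    intros
    ring
  rw [h]
  simp only [← Finset.sum_add_distrib]
  congr 1 <;>
  exact Finset.sum_congr rfl fun γ _ => Finset.sum_congr rfl fun σ _ => by ring

/-- After symmetrisation only two kinds of terms remain: `K` contracted with a covector,
antisymmetric by the antisymmetry of `K`, and `K` contracted with the torsion of `G`. Since that
torsion is pure trace, the second kind reduces to the first. -/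
theorem curvBilin_antisymm {G K : Conn} (hG : ∀ α β γ, torsionDefect G α β γ = 0)
    (hK : IsTorsionType K) (α β : Fin 4) : curvBilin G K α β + curvBilin G K β α = 0 := by
  have h1 : ∀ α β, ∑ γ, ∑ σ, (G γ β α * K σ σ γ + K γ β α * G σ σ γ) =
      ∑ γ, K γ β α * ∑ σ, G σ σ γ := fun α β => by
    refine Finset.sum_congr rfl fun γ _ => ?_
    rw [Finset.sum_add_distrib, ← Finset.mul_sum, ← Finset.mul_sum, hK.2, mul_zero, zero_add]
  have h2 : ∀ α β, ∑ γ, ∑ σ, (G γ β σ * K σ γ α + K γ β σ * G σ γ α) =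
      ∑ γ, ∑ σ, (G γ β σ * K σ γ α - K σ γ β * G γ σ α) := fun α β => by
    simp only [Finset.sum_add_distrib, sub_eq_add_neg,
      Finset.sum_neg_distrib]
    congr 1
    rw [Finset.sum_comm, ← Finset.sum_neg_distrib]
    refine Finset.sum_congr rfl fun γ _ => ?_
    rw [← Finset.sum_neg_distrib]
    refine Finset.sum_congr rfl fun σ _ => ?_
    rw [hK.1 σ β γ]
    ring
  -- Of the two delta terms of the pure-trace torsion, the one with `δ^γ_σ` is killed by the
  -- vanishing trace of `K`.
  have h3 : ∀ α β, ∑ γ, ∑ σ, K σ γ α * (G γ β σ - G γ σ β) =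
      ∑ σ, K σ β α * (torsionTrace G σ / 3) := fun α β => by
    have hT : ∀ γ σ, K σ γ α * (G γ β σ - G γ σ β) =
        (if γ = β then K σ γ α * (torsionTrace G σ / 3) else 0) -
          (if γ = σ then K σ γ α * (torsionTrace G β / 3) else 0) := fun γ σ => by
      have h := hG γ β σ
      rw [torsionDefect, torsion, delta, delta] at h
      rw [show G γ β σ - G γ σ β = 1 / 3 * (if γ = β then 1 else 0) * torsionTrace G σ -
        1 / 3 * (if γ = σ then 1 else 0) * torsionTrace G β by linarith]
      split_ifs <;> ring
    rw [Finset.sum_comm]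
    simp only [hT, Finset.sum_sub_distrib, Finset.sum_ite_eq', Finset.mem_univ, if_true,
      ← Finset.sum_mul, hK.2]
    ring
  have h4 : (∑ γ, ∑ σ, (G γ β σ * K σ γ α - K σ γ β * G γ σ α)) +
      (∑ γ, ∑ σ, (G γ α σ * K σ γ β - K σ γ α * G γ σ β)) =
      (∑ γ, ∑ σ, K σ γ α * (G γ β σ - G γ σ β)) +
        ∑ γ, ∑ σ, K σ γ β * (G γ α σ - G γ σ α) := by
    simp only [← Finset.sum_add_distrib]
    exact Finset.sum_congr rfl fun γ _ => Finset.sum_congr rfl fun σ _ => by ring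
  have h5 : ∀ c : Fin 4 → ℝ, (∑ γ, K γ β α * c γ) + ∑ γ, K γ α β * c γ = 0 := fun c => by
    rw [← Finset.sum_add_distrib]
    refine Finset.sum_eq_zero fun γ _ => ?_
    rw [hK.1 γ β α]
    ring
  rw [curvBilin, curvBilin, h1, h1, h2, h2]
  rw [h3, h3, h5] at h4
  have h6 := h5 fun γ => ∑ σ, G σ σ γ
  linarith

/-- Along the line the trace part drops out of the quadratic curvature, and the linear term in `K`
is antisymmetric, hence invisible to the metric density; only a second-order term in `K` remains. -/
theorem fderiv_energy_trace_add_torsion {p : JPt} (hp : p ∈ regular)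
    (ht : ∀ α β γ, torsionDefect p.2.1.2 α β γ = 0) (C : Fin 4 → ℝ) {K : Conn}
    (hK : IsTorsionType K) (w : Fin 4 → Fib) :
    fderiv ℝ (energy lagrangian) p (0, (0, traceArray C + K), w) = 0 := by
  refine fderiv_apply_of_line (b := -contr (density p.2.1.1) (curvQuad K))
    (differentiableAt_energy hp) fun t => ?_
  have hg : (p + t • ((0, (0, traceArray C + K), w) : JPt)).2.1.1 = p.2.1.1 := by simp
  have hr : p + t • ((0, (0, traceArray C + K), w) : JPt) ∈ regular := by
    change (Matrix.of (p + t • ((0, (0, traceArray C + K), w) : JPt)).2.1.1.1).det ≠ 0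
    rw [hg]
    exact hp
  rw [energy_lagrangian hr, energy_lagrangian hp, hg]
  have hG : curvQuad (p + t • ((0, (0, traceArray C + K), w) : JPt)).2.1.2 =
      curvQuad p.2.1.2 + t • curvBilin p.2.1.2 K + t ^ 2 • curvQuad K := by
    ext α β
    have h1 : (p + t • ((0, (0, traceArray C + K), w) : JPt)).2.1.2 =
        p.2.1.2 + t • K + traceArray (t • C) := by
      ext a b c
      simp only [Prod.snd_add, Prod.smul_snd, Prod.fst_add, Prod.smul_fst, Pi.add_apply,
        Pi.smul_apply, smul_eq_mul, traceArray]
      ring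
    rw [h1, curvQuad_add_traceArray, curvQuad_add_smul]
    rfl
  have hB : contr (density p.2.1.1) (curvBilin p.2.1.2 K) = 0 := by
    rw [← map_zero (contr (density p.2.1.1))]
    refine contr_eq_of_symmetric_part _ fun α β => ?_
    rw [curvBilin_antisymm ht hK]
    simp
  rw [hG, map_add, map_add, map_smul, map_smul, hB]
  simp only [smul_eq_mul]
  ring

/-! ### Vertical solutions of the kernel equation -/

/-- The matrix is the identity with row `μ` erased. For `ν = μ` the new column refills the diagonal;
for `ν ≠ μ` it overwrites the only nonzero entry of row `ν` by zero. -/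
theorem cramer_of_single_row (μ : Fin 4) (b : Fin 4 → ℝ) (ν : Fin 4) :
    (Matrix.of fun i => if i = μ then (0 : Base) else bvec i).cramer
      (fun i => if i = μ then b ν else 0) ν = if ν = μ then b μ else 0 := by
  rw [Matrix.cramer_apply]
  split_ifs with h
  · subst h
    have : (Matrix.of fun i => if i = ν then (0 : Base) else bvec i).updateCol ν
        (fun i => if i = ν then b ν else 0) =
        Matrix.diagonal fun i => if i = ν then b ν else 1 := by
      ext i j
      rw [Matrix.updateCol_apply, Matrix.diagonal_apply, Matrix.of_apply]
      rcases eq_or_ne j ν with rfl | hj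
      · rw [if_pos rfl]
        split_ifs <;> rfl
      · rcases eq_or_ne i ν with rfl | hi
        · simp [hj, hj.symm]
        · rw [if_neg hj, if_neg hi, bvec, Pi.single_apply, if_neg hi]
          exact if_congr eq_comm rfl rfl
    rw [this, Matrix.det_diagonal]
    simp
  · refine Matrix.det_eq_zero_of_row_eq_zero ν fun j => ?_
    rw [Matrix.updateCol_apply, if_neg h, Matrix.of_apply, if_neg h]
    split_ifs with hj
    · rfl
    · simp [bvec, hj]

/-- Obtained by evaluating on lifts of three coordinate vectors `∂/∂x^i`, `i ≠ μ`, with zero fibre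
part, and of the vertical variation `(k, l)` in slot `μ`. The base matrix is singular, so the energy
term disappears. -/
theorem InKernel.mom_eq {p u : JPt} (hp : p ∈ regular) (hu : u.1 = 0) (h : InKernel p u)
    (μ : Fin 4) (k : Sym) {l : Conn} (hl : ∀ α β γ, torsionDefect l α β γ = 0) :
    mom (fderiv ℝ density p.2.1.1 k) μ u.2.1.2 =
      mom (fderiv ℝ density p.2.1.1 u.2.1.1) μ l := by
  have h0 : ∀ α β γ, torsionDefect 0 α β γ = 0 := torsionDefect_eq_zero fun _ _ _ => rfl
  obtain ⟨w, hw⟩ := exists_isTangent hp 0 k hl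
  choose w' hw' using fun i => exists_isTangent hp (bvec i) 0 h0
  set W : Fin 4 → JPt := fun i =>
    if i = μ then ((0, (k, l), w) : JPt) else (bvec i, (0, 0), w' i) with hW
  have h1 := h W fun i => by
    simp only [hW]
    split_ifs
    exacts [hw, hw' i]
  have hX : baseMatrix W = Matrix.of fun i => if i = μ then (0 : Base) else bvec i := by
    ext i j
    simp only [baseMatrix, Matrix.of_apply, hW]
    split_ifs <;> rfl
  have hd : (baseMatrix W).det = 0 :=
    Matrix.det_eq_zero_of_row_eq_zero μ fun j => by simp [hX]
  have ha : ∀ ν, (fun i => mom (fderiv ℝ density p.2.1.1 (W i).2.1.1) ν u.2.1.2) =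
      fun i => if i = μ then mom (fderiv ℝ density p.2.1.1 k) ν u.2.1.2 else 0 := fun ν => by
    ext i
    simp only [hW]
    split_ifs
    · rfl
    · rw [map_zero, mom_zero_left]
  have hb : ∀ ν, (fun i => mom (fderiv ℝ density p.2.1.1 u.2.1.1) ν (W i).2.1.2) =
      fun i => if i = μ then mom (fderiv ℝ density p.2.1.1 u.2.1.1) ν l else 0 := fun ν => by
    ext i
    simp only [hW]
    split_ifs
    · rfl
    · rw [mom_zero_right]
  rw [omega_vertical hp hu, hd] at h1
  simp only [ha, hb] at h1
  rw [hX] at h1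
  simp only [cramer_of_single_row μ fun ν => mom (fderiv ℝ density p.2.1.1 k) ν u.2.1.2,
    cramer_of_single_row μ fun ν => mom (fderiv ℝ density p.2.1.1 u.2.1.1) ν l,
    Finset.sum_ite_eq', Finset.mem_univ, if_true] at h1
  linarith

/-- Taking `k = 0` with `l` free gives `h = 0`; taking `l = 0` with `k` free then constrains `f`. -/
theorem inKernel_iff {U : Set Base} {p : JPt} (hp : p ∈ finalSet U) (h : Sym) (f : Conn)
    (w : Fin 4 → Fib) :
    InKernel p (0, (h, f), w) ↔
      h = 0 ∧ ∃ (C : Fin 4 → ℝ) (K : Conn), IsTorsionType K ∧ f = traceArray C + K := by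
  have hr : p ∈ regular := jDom_subset_regular U hp.1
  constructor
  · intro hk
    have h0 : ∀ α β γ, torsionDefect 0 α β γ = 0 := torsionDefect_eq_zero fun _ _ _ => rfl
    have h1 : fderiv ℝ density p.2.1.1 h = 0 := eq_zero_of_mom fun μ l hl => by
      have := hk.mom_eq hr rfl μ 0 hl
      rw [map_zero, mom_zero_left] at this
      exact this.symm
    refine ⟨fderiv_density_injective hr (h1.trans (map_zero _).symm),
      exists_trace_add_torsion fun a μ => ?_⟩
    obtain ⟨k, rfl⟩ := fderiv_density_surjective hr a
    have := hk.mom_eq hr rfl μ k h0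
    rwa [mom_zero_right] at this
  -- Tangency of the test vectors is not needed here: `i(u) Ω` vanishes on all vectors, because `t =
  -- 0` at `p`.
  · rintro ⟨rfl, C, K, hK, rfl⟩ W -
    rw [omega_vertical hr rfl, fderiv_energy_trace_add_torsion hr
      (constraints_forall.1 hp.2).2.2.1 C hK]
    have hz : ∀ μ, (baseMatrix W).cramer (fun _ => 0) μ = 0 := fun μ =>
      congrFun (map_zero (baseMatrix W).cramer) μ
    simp only [mom_trace_add_torsion _ _ _ hK, map_zero, mom_zero_left, hz,
      Finset.sum_const_zero]
    ring

/-- The factor is `1 - 4`, the dimension entering through `δ^ν_ν`; it explains the thirds in the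
constraints. -/
theorem torsionTrace_traceArray (C : Fin 4 → ℝ) (γ : Fin 4) :
    torsionTrace (traceArray C) γ = -3 * C γ := by
  simp only [torsionTrace, torsion, Finset.sum_sub_distrib, traceArray_trace]
  simp [traceArray, delta]
  ring

theorem torsionDefect_traceArray (C : Fin 4 → ℝ) (α β γ : Fin 4) :
    torsionDefect (traceArray C) α β γ = 0 := by
  rw [torsionDefect, torsionTrace_traceArray, torsionTrace_traceArray, torsion, traceArray, traceArray]
  ring

theorem torsionDefect_torsionType {K : Conn} (hK : IsTorsionType K) (α β γ : Fin 4) :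
    torsionDefect K α β γ = 2 * K α β γ := by
  have h : ∀ γ, torsionTrace K γ = 0 := fun γ => by
    have : ∀ ν, torsion K ν ν γ = 2 * K ν ν γ := fun ν => by
      rw [torsion, hK.1 ν γ ν]
      ring
    simp only [torsionTrace, this, ← Finset.mul_sum, hK.2, mul_zero]
  rw [torsionDefect, h, h, torsion, hK.1 α γ β]
  ring

theorem fderiv_consT (p : JPt) (x : Base) (y : Fib) (w : Fin 4 → Fib) (α β γ : Fin 4) :
    fderiv ℝ (consT α β γ) p (x, y, w) = torsionDefect y.2 α β γ := by
  refine fderiv_apply_of_line (b := 0)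
    ((contDiff_consT (n := 1) α β γ).contDiffAt.differentiableAt one_ne_zero) fun t => ?_
  change torsionDefect (p.2.1.2 + t • y.2) α β γ = torsionDefect p.2.1.2 α β γ + _ + _
  rw [torsionDefect_add, torsionDefect_smul, smul_zero, add_zero, smul_eq_mul]

/-- The differentials of the constraints `t` alone decide: they annihilate traces and equal `2K` on
torsion-type arrays. -/
theorem IsTangent.torsionType_eq_zero {p : JPt} {h : Sym} {C : Fin 4 → ℝ} {K : Conn}
    {w : Fin 4 → Fib} (hK : IsTorsionType K)
    (ht : IsTangent p (0, (h, traceArray C + K), w)) : K = 0 := by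
  ext α β γ
  have h1 := (constraints_forall.1 ht).2.2.1 α β γ
  rw [fderiv_consT, torsionDefect_add, torsionDefect_traceArray, torsionDefect_torsionType hK]
    at h1
  simp only [Pi.zero_apply]
  linarith

/-! ### Changes of coordinates -/

/-- A change of coordinates that is smooth in both directions. -/
structure IsSmoothChange (τ : OpenPartialHomeomorph Base Base) : Prop where
  forward : ContDiffOn ℝ ∞ τ τ.source
  backward : ContDiffOn ℝ ∞ τ.symm τ.target

theorem isSmoothChange_of_charts {M : Type*} [TopologicalSpace M] [ChartedSpace Base M]
    {e e' : OpenPartialHomeomorph M Base} (he : e ∈ Charts M) (he' : e' ∈ Charts M) :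
    IsSmoothChange (e.symm.trans e') := by
  have h := IsManifold.compatible_of_mem_maximalAtlas he he'
  rw [contDiffGroupoid, mem_groupoid_of_pregroupoid] at h
  simp only [contDiffPregroupoid, modelWithCornersSelf_coe, modelWithCornersSelf_coe_symm,
    Function.comp_id, Function.id_comp, Set.preimage_id, Set.range_id, Set.inter_univ] at h
  exact ⟨h.1, h.2⟩

theorem clm_apply_eq_sum {F : Type*} [NormedAddCommGroup F] [NormedSpace ℝ F] (A : Base →L[ℝ] F)
    (v : Base) : A v = ∑ l, v l • A (bvec l) := by
  conv_lhs => rw [← Finset.univ_sum_single v]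
  rw [map_sum]
  refine Finset.sum_congr rfl fun l _ => ?_
  rw [← map_smul, bvec, ← Pi.single_smul, smul_eq_mul, mul_one]

theorem fderiv_apply_eq_sum_jac {τ : Base → Base} {x : Base} (v : Base) (α : Fin 4) :
    fderiv ℝ τ x v α = ∑ l, jac τ x α l * v l := by
  rw [clm_apply_eq_sum (fderiv ℝ τ x) v, Finset.sum_apply]
  exact Finset.sum_congr rfl fun l _ => mul_comm _ _

namespace IsSmoothChange

variable {τ : OpenPartialHomeomorph Base Base}

theorem contDiffAt (hτ : IsSmoothChange τ) {x : Base} (hx : x ∈ τ.source) :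
    ContDiffAt ℝ ∞ τ x :=
  hτ.forward.contDiffAt (τ.open_source.mem_nhds hx)

theorem contDiffAt_symm (hτ : IsSmoothChange τ) {x : Base} (hx : x ∈ τ.source) :
    ContDiffAt ℝ ∞ τ.symm (τ x) :=
  hτ.backward.contDiffAt (τ.open_target.mem_nhds (τ.map_source hx))

theorem differentiableAt (hτ : IsSmoothChange τ) {x : Base} (hx : x ∈ τ.source) :
    DifferentiableAt ℝ τ x :=
  (hτ.contDiffAt hx).differentiableAt (by simp)

theorem differentiableAt_symm (hτ : IsSmoothChange τ) {x : Base} (hx : x ∈ τ.source) :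
    DifferentiableAt ℝ τ.symm (τ x) :=
  (hτ.contDiffAt_symm hx).differentiableAt (by simp)

theorem fderiv_symm_fderiv (hτ : IsSmoothChange τ) {x : Base} (hx : x ∈ τ.source) (v : Base) :
    fderiv ℝ τ.symm (τ x) (fderiv ℝ τ x v) = v := by
  have h1 := (hτ.differentiableAt_symm hx).hasFDerivAt.comp x (hτ.differentiableAt hx).hasFDerivAt
  have h2 : HasFDerivAt (τ.symm ∘ τ) (ContinuousLinearMap.id ℝ Base) x := by
    refine (hasFDerivAt_id x).congr_of_eventuallyEq ?_
    filter_upwards [τ.open_source.mem_nhds hx] with y hy using τ.left_inv hy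
  exact congrArg (fun A : Base →L[ℝ] Base => A v) (h1.unique h2)

theorem fderiv_fderiv_symm (hτ : IsSmoothChange τ) {x : Base} (hx : x ∈ τ.source) (v : Base) :
    fderiv ℝ τ x (fderiv ℝ τ.symm (τ x) v) = v := by
  have h0 : HasFDerivAt τ (fderiv ℝ τ x) (τ.symm (τ x)) := by
    rw [τ.left_inv hx]
    exact (hτ.differentiableAt hx).hasFDerivAt
  have h1 := h0.comp (τ x) (hτ.differentiableAt_symm hx).hasFDerivAt
  have h2 : HasFDerivAt (τ ∘ τ.symm) (ContinuousLinearMap.id ℝ Base) (τ x) := by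
    refine (hasFDerivAt_id (τ x)).congr_of_eventuallyEq ?_
    filter_upwards [τ.open_target.mem_nhds (τ.map_source hx)] with y hy using τ.right_inv hy
  exact congrArg (fun A : Base →L[ℝ] Base => A v) (h1.unique h2)

theorem sum_jac_symm_mul_jac (hτ : IsSmoothChange τ) {x : Base} (hx : x ∈ τ.source)
    (α β : Fin 4) : ∑ l, jac τ.symm (τ x) α l * jac τ x l β = delta α β := by
  have h := congrFun (hτ.fderiv_symm_fderiv hx (bvec β)) α
  rw [fderiv_apply_eq_sum_jac] at h
  refine h.trans ?_
  rw [bvec, Pi.single_apply, delta]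

theorem sum_jac_mul_jac_symm (hτ : IsSmoothChange τ) {x : Base} (hx : x ∈ τ.source)
    (α β : Fin 4) : ∑ l, jac τ x α l * jac τ.symm (τ x) l β = delta α β := by
  have h := congrFun (hτ.fderiv_fderiv_symm hx (bvec β)) α
  rw [fderiv_apply_eq_sum_jac] at h
  refine h.trans ?_
  rw [bvec, Pi.single_apply, delta]

/-! ### Smoothness of the induced changes of coordinates -/

theorem contDiffAt_jac {f : Base → Base} {x : Base} (hf : ContDiffAt ℝ ∞ f x) (α l : Fin 4) :
    ContDiffAt ℝ ∞ (fun y => jac f y α l) x := by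
  have h : ContDiffAt ℝ ∞ (fderiv ℝ f) x := hf.fderiv_right (by simp)
  exact contDiffAt_pi.1 (h.clm_apply contDiffAt_const) α

theorem contDiffAt_hess {f : Base → Base} {x : Base} (hf : ContDiffAt ℝ ∞ f x)
    (α β γ : Fin 4) : ContDiffAt ℝ ∞ (fun y => hess f y α β γ) x := by
  have h : ContDiffAt ℝ ∞ (fderiv ℝ fun z => jac f z α γ) x :=
    (contDiffAt_jac hf α γ).fderiv_right (by simp)
  exact h.clm_apply contDiffAt_const

theorem contDiffAt_jac_symm (hτ : IsSmoothChange τ) {x : Base} (hx : x ∈ τ.source)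
    (α l : Fin 4) : ContDiffAt ℝ ∞ (fun y => jac τ.symm (τ y) α l) x :=
  (contDiffAt_jac (hτ.contDiffAt_symm hx) α l).comp (g := fun y => jac τ.symm y α l) x
    (hτ.contDiffAt hx)

theorem contDiffAt_hess_symm (hτ : IsSmoothChange τ) {x : Base} (hx : x ∈ τ.source)
    (α β γ : Fin 4) : ContDiffAt ℝ ∞ (fun y => hess τ.symm (τ y) α β γ) x :=
  (contDiffAt_hess (hτ.contDiffAt_symm hx) α β γ).comp (g := fun y => hess τ.symm y α β γ) x
    (hτ.contDiffAt hx)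

theorem contDiffAt_liftE (hτ : IsSmoothChange τ) {q : EPt} (hq : q.1 ∈ τ.source) :
    ContDiffAt ℝ ∞ (liftE τ) q := by
  have hf : ContDiffAt ℝ ∞ (fun q : EPt => q.1) q := by fun_prop
  have hj : ∀ α l, ContDiffAt ℝ ∞ (fun q : EPt => jac τ q.1 α l) q := fun α l =>
    (contDiffAt_jac (hτ.contDiffAt hq) α l).comp (g := fun y => jac τ y α l) q hf
  have hj' : ∀ α l, ContDiffAt ℝ ∞ (fun q : EPt => jac τ.symm (τ q.1) α l) q := fun α l =>
    (hτ.contDiffAt_jac_symm hq α l).comp (g := fun y => jac τ.symm (τ y) α l) q hf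
  have hh : ∀ α β γ, ContDiffAt ℝ ∞ (fun q : EPt => hess τ.symm (τ q.1) α β γ) q := fun α β γ =>
    (hτ.contDiffAt_hess_symm hq α β γ).comp (g := fun y => hess τ.symm (τ y) α β γ) q hf
  have hg : ∀ α β, ContDiffAt ℝ ∞ (fun q : EPt => q.2.1.1 α β) q := fun α β => by
    have : ContDiffAt ℝ ∞ (fun q : EPt => q.2.1) q := by fun_prop
    exact (symCoord α β).contDiff.contDiffAt.comp q this
  have hG : ∀ α β γ, ContDiffAt ℝ ∞ (fun q : EPt => q.2.2 α β γ) q := fun α β γ => by fun_prop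
  refine ((hτ.contDiffAt hq).comp q hf).prodMk (ContDiffAt.prodMk (contDiffAt_sym fun α β => ?_)
    (contDiffAt_pi.2 fun α => contDiffAt_pi.2 fun β => contDiffAt_pi.2 fun γ => ?_))
  · change ContDiffAt ℝ ∞ (fun y : EPt => ∑ μ, ∑ ν, jac τ.symm (τ y.1) μ α *
      jac τ.symm (τ y.1) ν β * y.2.1.1 μ ν) q
    exact ContDiffAt.sum fun μ _ => ContDiffAt.sum fun ν _ =>
      ((hj' μ α).mul (hj' ν β)).mul (hg μ ν)
  · exact ContDiffAt.sum fun l _ => (hj α l).mul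
      ((ContDiffAt.sum fun μ _ => ContDiffAt.sum fun ν _ =>
        ((hj' μ β).mul (hj' ν γ)).mul (hG l μ ν)).add (hh l β γ))

/-! ### Lorentzian forms under changes of coordinates -/

theorem form_liftE (q : EPt) (v w : Base) :
    form (liftE τ q).2.1 v w =
      form q.2.1 (fderiv ℝ τ.symm (τ q.1) v) (fderiv ℝ τ.symm (τ q.1) w) := by
  simp only [form, fderiv_apply_eq_sum_jac, liftE, Finset.mul_sum, Finset.sum_mul]
  have h : ∀ F : Fin 4 → Fin 4 → Fin 4 → Fin 4 → ℝ, ∑ α, ∑ β, ∑ μ, ∑ ν, F α β μ ν =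
      ∑ μ, ∑ ν, ∑ β, ∑ α, F α β μ ν := fun F => by
    rw [Finset.sum_comm]
    calc ∑ β, ∑ α, ∑ μ, ∑ ν, F α β μ ν = ∑ β, ∑ μ, ∑ α, ∑ ν, F α β μ ν :=
          Finset.sum_congr rfl fun β _ => Finset.sum_comm
      _ = ∑ μ, ∑ β, ∑ α, ∑ ν, F α β μ ν := Finset.sum_comm
      _ = ∑ μ, ∑ β, ∑ ν, ∑ α, F α β μ ν := Finset.sum_congr rfl fun μ _ =>
          Finset.sum_congr rfl fun β _ => Finset.sum_comm
      _ = _ := Finset.sum_congr rfl fun μ _ => Finset.sum_comm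
  rw [h]
  exact Finset.sum_congr rfl fun μ _ => Finset.sum_congr rfl fun ν _ =>
    Finset.sum_congr rfl fun β _ => Finset.sum_congr rfl fun α _ => by ring

/-- The new metric is the pullback by the inverse change, so the image of the timelike vector `t`
serves as witness. -/
theorem liftE_mem (hτ : IsSmoothChange τ) {q : EPt} (hq : q ∈ eDom τ.source) :
    liftE τ q ∈ eDom τ.target := by
  refine ⟨τ.map_source hq.1, ?_⟩
  obtain ⟨t, ht, hpos⟩ := hq.2
  refine ⟨fderiv ℝ τ q.1 t, ?_, fun w hw h0 => ?_⟩
  · change form _ _ _ < 0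
    rw [form_liftE, hτ.fderiv_symm_fderiv hq.1]
    exact ht
  · change form _ _ _ = 0 at h0
    change 0 < form _ _ _
    rw [form_liftE, hτ.fderiv_symm_fderiv hq.1] at h0
    rw [form_liftE]
    refine hpos _ (fun h => hw ?_) h0
    rw [← hτ.fderiv_fderiv_symm hq.1 w, h, map_zero]

end IsSmoothChange

/-! ### Vertical vectors under changes of coordinates -/

/-- The tensorial transformation law of differences of connections. -/
def tensorLaw (τ : OpenPartialHomeomorph Base Base) (x : Base) (f : Conn) : Conn := fun α β γ =>
  ∑ l, jac τ x α l *
    ∑ μ, ∑ ν, jac τ.symm (τ x) μ β * jac τ.symm (τ x) ν γ * f l μ ν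

theorem liftE_add_snd_snd (τ : OpenPartialHomeomorph Base Base) (q : EPt) (h : Sym) (f : Conn)
    (t : ℝ) : (liftE τ (q + t • ((0, (h, f)) : EPt))).2.2 =
      (liftE τ q).2.2 + t • tensorLaw τ q.1 f := by
  ext α β γ
  have h1 : (q + t • ((0, (h, f)) : EPt)).1 = q.1 := by simp
  simp only [liftE, h1]
  simp only [Pi.add_apply, Pi.smul_apply, smul_eq_mul, tensorLaw, Finset.mul_sum (a := t),
    ← Finset.sum_add_distrib]
  refine Finset.sum_congr rfl fun l _ => ?_
  have h2 : ∀ μ ν, (q + t • ((0, (h, f)) : EPt)).2.2 l μ ν = q.2.2 l μ ν + t * f l μ ν :=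
    fun _ _ => rfl
  simp only [h2, mul_add, Finset.sum_add_distrib]
  have h3 : ∑ μ, ∑ ν, jac τ.symm (τ q.1) μ β * jac τ.symm (τ q.1) ν γ * (t * f l μ ν) =
      t * ∑ μ, ∑ ν, jac τ.symm (τ q.1) μ β * jac τ.symm (τ q.1) ν γ * f l μ ν := by
    simp only [Finset.mul_sum]
    exact Finset.sum_congr rfl fun μ _ => Finset.sum_congr rfl fun ν _ => by ring
  rw [h3]
  ring

/-- The inhomogeneous second-derivative term of the transformation law cancels in differences of
connections. -/
theorem liftE_add_conn (τ : OpenPartialHomeomorph Base Base) (q : EPt) (f : Conn) (t : ℝ) :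
    liftE τ (q + t • ((0, (0, f)) : EPt)) =
      liftE τ q + t • ((0, (0, tensorLaw τ q.1 f)) : EPt) := by
  refine Prod.ext ?_ (Prod.ext ?_ ?_)
  · simp [liftE]
  · have h1 : (q + t • ((0, (0, f)) : EPt)).1 = q.1 := by simp
    have h2 : (q + t • ((0, (0, f)) : EPt)).2.1 = q.2.1 := by simp
    ext α β
    simp only [liftE, h1, h2]
    simp
  · rw [liftE_add_snd_snd]
    simp

namespace IsSmoothChange

variable {τ : OpenPartialHomeomorph Base Base}

theorem fderiv_liftE_conn (hτ : IsSmoothChange τ) {q : EPt} (hq : q.1 ∈ τ.source) (f : Conn) :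
    fderiv ℝ (liftE τ) q (0, (0, f)) = (0, (0, tensorLaw τ q.1 f)) :=
  fderiv_apply_of_line (b := 0) ((hτ.contDiffAt_liftE hq).differentiableAt (by simp)) fun t => by
    rw [liftE_add_conn, smul_zero, add_zero]

theorem fderiv_liftE_snd_snd (hτ : IsSmoothChange τ) {q : EPt} (hq : q.1 ∈ τ.source) (h : Sym)
    (f : Conn) : (fderiv ℝ (liftE τ) q (0, (h, f))).2.2 = tensorLaw τ q.1 f := by
  have hd := (hτ.contDiffAt_liftE hq).differentiableAt (by simp)
  have h1 : HasFDerivAt (fun q => (liftE τ q).2.2) _ q := hd.hasFDerivAt.snd.snd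
  have h2 : fderiv ℝ (fun q => (liftE τ q).2.2) q (0, (h, f)) = tensorLaw τ q.1 f :=
    fderiv_apply_of_line (b := 0) h1.differentiableAt fun t => by
      rw [liftE_add_snd_snd, smul_zero, add_zero]
  rw [h1.fderiv] at h2
  exact h2

theorem tensorLaw_traceArray (hτ : IsSmoothChange τ) {x : Base} (hx : x ∈ τ.source)
    {C C' : Fin 4 → ℝ} (hC : ∀ β, C β = ∑ γ, C' γ * jac τ x γ β) :
    tensorLaw τ x (traceArray C) = traceArray C' := by
  have h1 : ∀ β, ∑ μ, jac τ.symm (τ x) μ β * C μ = C' β := fun β => by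
    simp only [hC, Finset.mul_sum]
    rw [Finset.sum_comm]
    have : ∀ γ, ∑ μ, jac τ.symm (τ x) μ β * (C' γ * jac τ x γ μ) = C' γ * delta γ β := fun γ => by
      rw [← hτ.sum_jac_mul_jac_symm hx, Finset.mul_sum]
      exact Finset.sum_congr rfl fun μ _ => by ring
    simp [this, delta]
  ext α β γ
  have h2 : ∀ l, ∑ μ, ∑ ν, jac τ.symm (τ x) μ β * jac τ.symm (τ x) ν γ * traceArray C l μ ν =
      jac τ.symm (τ x) l γ * C' β := fun l => by
    rw [← h1 β, Finset.mul_sum]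
    refine Finset.sum_congr rfl fun μ _ => ?_
    simp only [traceArray, delta]
    simp
    ring
  simp only [tensorLaw, h2, ← mul_assoc, ← Finset.sum_mul, hτ.sum_jac_mul_jac_symm hx]
  exact mul_comm _ _

/-- Contraction over the first pair of indices pairs a Jacobian with its inverse, so the trace
transforms as a covector. This makes `EField.traceForm` globally well defined. -/
theorem torsionTrace_tensorLaw (hτ : IsSmoothChange τ) {x : Base} (hx : x ∈ τ.source) (f : Conn)
    (γ : Fin 4) : torsionTrace (tensorLaw τ x f) γ =
      ∑ ν, jac τ.symm (τ x) ν γ * torsionTrace f ν := by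
  have h1 : ∀ α, torsion (tensorLaw τ x f) α α γ =
      ∑ ν, jac τ.symm (τ x) ν γ * ∑ l, ∑ μ, jac τ.symm (τ x) μ α * jac τ x α l * torsion f l μ ν := by
    intro α
    simp only [torsion, tensorLaw]
    rw [← Finset.sum_sub_distrib]
    have h2 : ∀ l, ∑ μ, ∑ ν, jac τ.symm (τ x) μ γ * jac τ.symm (τ x) ν α * f l μ ν =
        ∑ μ, ∑ ν, jac τ.symm (τ x) ν γ * jac τ.symm (τ x) μ α * f l ν μ := fun l =>
      Finset.sum_comm
    simp only [h2, ← mul_sub, ← Finset.sum_sub_distrib, Finset.mul_sum]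
    rw [Finset.sum_comm' (t' := Finset.univ) (s' := fun _ => Finset.univ) (by simp)]
    have h3 : ∀ F : Fin 4 → Fin 4 → Fin 4 → ℝ, ∑ μ, ∑ l, ∑ ν, F μ l ν = ∑ ν, ∑ l, ∑ μ, F μ l ν :=
      fun F => by
        rw [Finset.sum_comm]
        rw [Finset.sum_comm (s := Finset.univ (α := Fin 4)) (t := Finset.univ (α := Fin 4))
          (f := fun ν l => ∑ μ, F μ l ν)]
        exact Finset.sum_congr rfl fun l _ => Finset.sum_comm
    rw [h3]
    exact Finset.sum_congr rfl fun ν _ => Finset.sum_congr rfl fun l _ =>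
      Finset.sum_congr rfl fun μ _ => by ring
  simp only [torsionTrace, h1]
  rw [Finset.sum_comm]
  refine Finset.sum_congr rfl fun ν _ => ?_
  rw [← Finset.mul_sum]
  congr 1
  rw [Finset.sum_comm]
  refine Finset.sum_congr rfl fun l _ => ?_
  rw [Finset.sum_comm]
  simp only [← Finset.sum_mul, hτ.sum_jac_symm_mul_jac hx, delta]
  simp

theorem sum_torsionTrace_mul_jac (hτ : IsSmoothChange τ) {x : Base} (hx : x ∈ τ.source) (f : Conn)
    (β : Fin 4) : ∑ γ, torsionTrace (tensorLaw τ x f) γ * jac τ x γ β = torsionTrace f β := by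
  simp only [hτ.torsionTrace_tensorLaw hx, Finset.sum_mul]
  rw [Finset.sum_comm]
  have h : ∀ ν, ∑ γ, jac τ.symm (τ x) ν γ * torsionTrace f ν * jac τ x γ β =
      torsionTrace f ν * delta ν β := fun ν => by
    rw [← hτ.sum_jac_symm_mul_jac hx, Finset.mul_sum]
    exact Finset.sum_congr rfl fun γ _ => by ring
  simp only [h, delta]
  simp

/-! ### Prolongations under changes of coordinates -/

/-- The prolongation of a vertical vector field transforms by the prolongation of the change of
coordinates. -/
theorem fderiv_liftJ_prolong (hτ : IsSmoothChange τ) {η η' : EPt → Fib} {p : JPt}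
    (hp : p.1 ∈ τ.source) (hη : DifferentiableAt ℝ η (toE p))
    (hη' : DifferentiableAt ℝ η' (liftE τ (toE p)))
    (hc : ∀ᶠ q in nhds (toE p), fderiv ℝ (liftE τ) q (0, η q) = (0, η' (liftE τ q))) :
    fderiv ℝ (liftJ τ) p (0, η (toE p), fun μ => totalD η μ p) =
      (0, η' (toE (liftJ τ p)), fun μ => totalD η' μ (liftJ τ p)) := by
  set q := toE p with hq
  have hΦ : ContDiffAt ℝ ∞ (liftE τ) q := hτ.contDiffAt_liftE hp
  have hφ : ContDiffAt ℝ ∞ (fun q => (liftE τ q).2) q := hΦ.snd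
  have hΦd : HasFDerivAt (liftE τ) (fderiv ℝ (liftE τ) q) q :=
    (hΦ.differentiableAt (by simp)).hasFDerivAt
  set φ : EPt → Fib := fun q => (liftE τ q).2 with hφdef
  have hφ1 : HasFDerivAt φ ((ContinuousLinearMap.snd ℝ Base Fib).comp (fderiv ℝ (liftE τ) q)) q :=
    hΦd.snd
  have hφ2 : HasFDerivAt (fderiv ℝ φ) (fderiv ℝ (fderiv ℝ φ) q) q :=
    ((hφ.fderiv_right (m := 1)
      (WithTop.coe_le_coe.2 (le_top (a := (2 : ℕ∞))))).differentiableAt one_ne_zero).hasFDerivAt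
  have hsymm : IsSymmSndFDerivAt ℝ φ q := hφ.isSymmSndFDerivAt (by
    rw [minSmoothness_of_isRCLikeNormedField]
    exact ENat.LEInfty.out)
  set u : JPt := (0, η q, fun μ => totalD η μ p) with hu
  -- the derivative of `D_ν φ` along the prolongation
  have hA : ∀ ν, HasFDerivAt (fun p : JPt => totalD φ ν p)
      (fderiv ℝ (fun p : JPt => totalD φ ν p) p) p ∧
      fderiv ℝ (fun p : JPt => totalD φ ν p) p u =
        fderiv ℝ η' (liftE τ q) (fderiv ℝ (liftE τ) q (bvec ν, p.2.2 ν)) := by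
    intro ν
    have hE : HasFDerivAt toE ((ContinuousLinearMap.fst ℝ Base (Fib × (Fin 4 → Fib))).prod dy) p :=
      ((ContinuousLinearMap.fst ℝ Base (Fib × (Fin 4 → Fib))).prod dy).hasFDerivAt
    set V : JPt →L[ℝ] EPt := (0 : JPt →L[ℝ] Base).prod
      ((ContinuousLinearMap.proj (R := ℝ) (φ := fun _ : Fin 4 => Fib) ν).comp
        ((ContinuousLinearMap.snd ℝ Fib (Fin 4 → Fib)).comp
          (ContinuousLinearMap.snd ℝ Base (Fib × (Fin 4 → Fib))))) with hV
    have hv : HasFDerivAt (fun p : JPt => ((bvec ν, p.2.2 ν) : EPt)) V p := by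
      have h := V.hasFDerivAt (x := p) |>.const_add ((bvec ν, 0) : EPt)
      refine h.congr_of_eventuallyEq (Filter.Eventually.of_forall fun p => ?_)
      simp [hV]
    have h1 := (HasFDerivAt.comp (g := fderiv ℝ φ) p hφ2 hE).clm_apply hv
    have h2 : HasFDerivAt (fun p : JPt => totalD φ ν p) _ p := h1
    refine ⟨h2.differentiableAt.hasFDerivAt, ?_⟩
    have h3 : HasFDerivAt (fun q => fderiv ℝ φ q (0, η q)) _ q :=
      hφ2.clm_apply ((hasFDerivAt_const (0 : Base) q).prodMk hη.hasFDerivAt)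
    have h4 : HasFDerivAt (fun q => η' (liftE τ q)) _ q := hη'.hasFDerivAt.comp q hΦd
    -- Relatedness of `η` and `η'` holds on a neighbourhood, so it may be differentiated along the
    -- total-derivative direction.
    have h5 : (fun q => fderiv ℝ φ q (0, η q)) =ᶠ[nhds q] fun q => η' (liftE τ q) := by
      have ho : ∀ᶠ q' : EPt in nhds q, q'.1 ∈ τ.source :=
        continuous_fst.continuousAt.eventually (τ.open_source.mem_nhds hp)
      filter_upwards [hc, ho] with q' hq' hs
      have h6 : HasFDerivAt φ ((ContinuousLinearMap.snd ℝ Base Fib).comp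
          (fderiv ℝ (liftE τ) q')) q' :=
        ((hτ.contDiffAt_liftE hs).differentiableAt (by simp)).hasFDerivAt.snd
      rw [h6.fderiv, ContinuousLinearMap.comp_apply, hq']
      rfl
    have h7 := (h3.congr_of_eventuallyEq h5.symm).unique h4
    have h8 := congrArg (fun A : EPt →L[ℝ] Fib => A (bvec ν, p.2.2 ν)) h7
    rw [h2.fderiv]
    refine Eq.trans ?_ h8
    -- Symmetry of the second derivative exchanges the vertical direction with the total-derivative
    -- direction.
    have h9 := hsymm.eq (0, η q) (bvec ν, p.2.2 ν)
    have h10 : ∀ a b c d : Fib, a = c → b = d → b + a = d + c := by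
      rintro a b c d rfl rfl
      rfl
    exact h10 _ _ _ _ h9 rfl
  -- the coefficients depend on `x` only
  have hJ : ∀ μ ν, HasFDerivAt (fun p : JPt => jac τ.symm (τ p.1) ν μ)
      (fderiv ℝ (fun p : JPt => jac τ.symm (τ p.1) ν μ) p) p := fun μ ν => by
    have h : ContDiffAt ℝ ∞ (fun p : JPt => jac τ.symm (τ p.1) ν μ) p :=
      (hτ.contDiffAt_jac_symm hp ν μ).comp (g := fun y => jac τ.symm (τ y) ν μ) p
        (by fun_prop)
    exact (h.differentiableAt (by simp)).hasFDerivAt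
  have hJu : ∀ μ ν, fderiv ℝ (fun p : JPt => jac τ.symm (τ p.1) ν μ) p u = 0 := fun μ ν =>
    fderiv_apply_eq_zero_of_line fun t => by simp [hu]
  have hE : HasFDerivAt toE ((ContinuousLinearMap.fst ℝ Base (Fib × (Fin 4 → Fib))).prod dy) p :=
    ((ContinuousLinearMap.fst ℝ Base (Fib × (Fin 4 → Fib))).prod dy).hasFDerivAt
  have hΦE := HasFDerivAt.comp (g := liftE τ) p hΦd hE
  have h3 : ∀ μ, HasFDerivAt (fun p : JPt => ∑ ν, jac τ.symm (τ p.1) ν μ • totalD φ ν p) _ p :=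
    fun μ => HasFDerivAt.fun_sum (u := Finset.univ) fun ν _ => (hJ μ ν).smul (hA ν).1
  have h4 : HasFDerivAt (liftJ τ) _ p := hΦE.fst.prodMk (hΦE.snd.prodMk (hasFDerivAt_pi.2 h3))
  have hbase : fderiv ℝ (liftE τ) q (0, η q) = (0, η' (liftE τ q)) := hc.self_of_nhds
  rw [h4.fderiv]
  refine Prod.ext ?_ (Prod.ext ?_ (funext fun μ => ?_))
  · have h := congrArg Prod.fst hbase
    exact h
  · have h := congrArg Prod.snd hbase
    exact h
  -- The new total-derivative vector is the combination, with the inverse Jacobian, of the images of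
  -- the old ones.
  · have h5 : (bvec μ, (liftJ τ p).2.2 μ) =
        ∑ ν, jac τ.symm (τ p.1) ν μ • fderiv ℝ (liftE τ) q (bvec ν, p.2.2 ν) := by
      refine Prod.ext ?_ ?_
      · rw [Prod.fst_sum]
        have h6 : ∀ ν, (fderiv ℝ (liftE τ) q (bvec ν, p.2.2 ν)).1 = fderiv ℝ τ p.1 (bvec ν) :=
          fun ν => by
            have h7 : HasFDerivAt (fun q => (liftE τ q).1) _ q := hΦd.fst
            have h8 : HasFDerivAt (fun q : EPt => τ q.1) _ q :=
              HasFDerivAt.comp (g := τ) q (hτ.differentiableAt hp).hasFDerivAt hasFDerivAt_fst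
            exact congrArg (fun A : EPt →L[ℝ] Base => A (bvec ν, p.2.2 ν)) (h7.unique h8)
        simp only [Prod.smul_fst, h6]
        have h9 := clm_apply_eq_sum (fderiv ℝ τ p.1) (fderiv ℝ τ.symm (τ p.1) (bvec μ))
        rw [hτ.fderiv_fderiv_symm hp] at h9
        exact h9
      · rw [Prod.snd_sum]
        change ∑ ν, jac τ.symm (τ p.1) ν μ • totalD φ ν p = _
        refine Finset.sum_congr rfl fun ν _ => ?_
        rw [Prod.smul_snd]
        congr 1
        change fderiv ℝ φ q _ = _
        rw [hφ1.fderiv]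
        rfl
    have h6 : totalD η' μ (liftJ τ p) =
        ∑ ν, jac τ.symm (τ p.1) ν μ • fderiv ℝ (fun p : JPt => totalD φ ν p) p u := by
      change fderiv ℝ η' (liftE τ q) (bvec μ, (liftJ τ p).2.2 μ) = _
      rw [h5, map_sum]
      refine Finset.sum_congr rfl fun ν _ => ?_
      rw [map_smul, (hA ν).2]
    refine Eq.trans ?_ h6.symm
    simp [hJu]

end IsSmoothChange

/-! ### Trace transformations -/

/-- The array `C_β δ^α_γ` as a continuous linear function of `C`, with values in the vertical
vectors of `E`. -/
def traceL : (Fin 4 → ℝ) →L[ℝ] Fib :=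
  (ContinuousLinearMap.inr ℝ Sym Conn).comp (LinearMap.toContinuousLinearMap
    { toFun := traceArray
      map_add' := fun C C' => by
        ext α β γ
        simp only [traceArray, Pi.add_apply]
        ring
      map_smul' := fun c C => by
        ext α β γ
        simp only [traceArray, Pi.smul_apply, smul_eq_mul, RingHom.id_apply]
        ring })

theorem traceL_apply (C : Fin 4 → ℝ) : traceL C = (0, traceArray C) := rfl

theorem totalD_trace {C : EPt → Fin 4 → ℝ} {p : JPt} (hC : DifferentiableAt ℝ C (toE p))
    (μ : Fin 4) :
    totalD (fun q => ((0, traceArray (C q)) : Fib)) μ p = (0, traceArray (totalD C μ p)) := by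
  have h : HasFDerivAt (fun q => ((0, traceArray (C q)) : Fib)) _ (toE p) :=
    traceL.hasFDerivAt.comp (toE p) hC.hasFDerivAt
  rw [totalD, h.fderiv]
  rfl

theorem gaugeVector_eq {C : EPt → Fin 4 → ℝ} {p : JPt} (hC : DifferentiableAt ℝ C (toE p)) :
    gaugeVector C p = (0, (0, traceArray (C (toE p))),
      fun μ => totalD (fun q => ((0, traceArray (C q)) : Fib)) μ p) := by
  simp only [totalD_trace hC]
  rfl

theorem prolong_trace {C : EPt → Fin 4 → ℝ} {p : JPt} (hC : DifferentiableAt ℝ C (toE p)) :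
    prolong (fun q => (0, (0, traceArray (C q)))) p = gaugeVector C p := by
  rw [gaugeVector_eq hC, prolong]
  have h : ∀ μ ν, totalD (fun _ : EPt => (0 : Base)) μ p ν = 0 := fun μ ν => by
    simp [totalD]
  simp only [h, zero_smul, Finset.sum_const_zero, sub_zero]

/-! ### Invariance of the constraints under trace transformations. -/

theorem sum_mul_delta_right (a : Fin 4 → ℝ) (β : Fin 4) : ∑ l, a l * delta l β = a β := by
  simp [delta]

/-- The two `Γ` terms change by `-2 g_{ρσ} C_μ` in total, and the torsion term by `-⅔ · (-3) g_{ρσ}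
C_μ`. -/
theorem consM_trace (p : JPt) (C : Fin 4 → ℝ) (D : Fin 4 → Fin 4 → ℝ) (ρ σ μ : Fin 4) :
    consM ρ σ μ (p + (0, (0, traceArray C), fun μ => (0, traceArray (D μ)))) = consM ρ σ μ p := by
  have h : ∀ ρ σ, ∑ l, p.2.1.1.1 ρ l * (p.2.1.2 l μ σ + C μ * delta l σ) =
      (∑ l, p.2.1.1.1 ρ l * p.2.1.2 l μ σ) + p.2.1.1.1 ρ σ * C μ := fun ρ σ => by
    rw [← sum_mul_delta_right (fun l => p.2.1.1.1 ρ l * C μ) σ, ← Finset.sum_add_distrib]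
    exact Finset.sum_congr rfl fun l _ => by ring
  have ht : torsionTrace (p.2.1.2 + traceArray C) μ = torsionTrace p.2.1.2 μ - 3 * C μ := by
    rw [torsionTrace_add, torsionTrace_traceArray]
    ring
  simp only [consM, dmetric, metric, gam, Prod.fst_add, Prod.snd_add, Pi.add_apply, add_zero, ht,
    traceArray, h]
  rw [p.2.1.1.2 σ ρ]
  ring

theorem intLin_trace (g : Sym) (D : Fin 4 → Fin 4 → ℝ) (ρ σ μ ν : Fin 4) :
    intLin g (fun μ => traceArray (D μ)) ρ σ μ ν = 0 := by
  have h : ∀ ρ σ, ∑ l, g.1 ρ l * (D ν μ * delta l σ - D μ ν * delta l σ) =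
      g.1 ρ σ * (D ν μ - D μ ν) := fun ρ σ => by
    rw [← sum_mul_delta_right (fun l => g.1 ρ l * (D ν μ - D μ ν)) σ]
    exact Finset.sum_congr rfl fun l _ => by ring
  simp only [intLin, torsionTrace_traceArray, traceArray, h]
  rw [g.2 σ ρ]
  ring

theorem consI_trace (p : JPt) (C : Fin 4 → ℝ) (D : Fin 4 → Fin 4 → ℝ) (ρ σ μ ν : Fin 4) :
    consI ρ σ μ ν (p + (0, (0, traceArray C), fun μ => (0, traceArray (D μ)))) =
      consI ρ σ μ ν p := by
  have h0 : p + ((0, (0, traceArray C), fun μ => (0, traceArray (D μ))) : JPt) =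
      (p.1, (p.2.1.1, p.2.1.2 + traceArray C), p.2.2 + fun μ => (0, traceArray (D μ))) := by
    refine Prod.ext (add_zero _) (Prod.ext (Prod.ext (add_zero _) rfl) rfl)
  -- All the added terms are together symmetric in `μ, ν`, so they drop out of the antisymmetrised
  -- constraint.
  have h1 : ∀ μ ν κ σ, ∑ l, (p.2.1.2 + traceArray C) κ ν l * (p.2.1.2 + traceArray C) l μ σ =
      (∑ l, p.2.1.2 κ ν l * p.2.1.2 l μ σ) + p.2.1.2 κ ν σ * C μ + C ν * p.2.1.2 κ μ σ +
        C ν * C μ * delta κ σ := fun μ ν κ σ => by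
    have : ∀ l, (p.2.1.2 + traceArray C) κ ν l * (p.2.1.2 + traceArray C) l μ σ =
        p.2.1.2 κ ν l * p.2.1.2 l μ σ + p.2.1.2 κ ν l * C μ * delta l σ +
          C ν * p.2.1.2 l μ σ * delta l κ + C ν * C μ * delta κ l * delta l σ := fun l => by
      simp only [Pi.add_apply, traceArray]
      rw [show delta l κ = delta κ l by simp only [delta, eq_comm]]
      ring
    simp only [this, Finset.sum_add_distrib, sum_mul_delta_right]
  have h2 : ∀ ρ σ, ∑ κ, ∑ l, p.2.1.1.1 ρ κ * ((p.2.1.2 + traceArray C) κ ν l *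
      (p.2.1.2 + traceArray C) l μ σ - (p.2.1.2 + traceArray C) κ μ l *
      (p.2.1.2 + traceArray C) l ν σ) = ∑ κ, ∑ l, p.2.1.1.1 ρ κ * (p.2.1.2 κ ν l *
      p.2.1.2 l μ σ - p.2.1.2 κ μ l * p.2.1.2 l ν σ) := fun ρ σ => by
    refine Finset.sum_congr rfl fun κ _ => ?_
    rw [← Finset.mul_sum, ← Finset.mul_sum, Finset.sum_sub_distrib, Finset.sum_sub_distrib, h1, h1]
    ring
  rw [h0, consI_add]
  have h3 := intLin_trace p.2.1.1 D ρ σ μ ν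
  refine (congrArg _ h3).trans ?_
  rw [add_zero]
  simp only [consI, metric, gam, dgam, h2]

/-- The Ricci tensor changes only by the antisymmetric `D_{αβ} - D_{βα}`, while the Einstein
equations see its symmetric part. -/
theorem consC_trace {p : JPt} (hp : p ∈ regular) (C : Fin 4 → ℝ) (D : Fin 4 → Fin 4 → ℝ)
    (μ ν : Fin 4) :
    consC μ ν (p + (0, (0, traceArray C), fun μ => (0, traceArray (D μ)))) = consC μ ν p := by
  have h0 : p + ((0, (0, traceArray C), fun μ => (0, traceArray (D μ))) : JPt) =
      (p.1, (p.2.1.1, p.2.1.2 + traceArray C), p.2.2 + fun μ => (0, traceArray (D μ))) := by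
    refine Prod.ext (add_zero _) (Prod.ext (Prod.ext (add_zero _) rfl) rfl)
  rw [h0, consC_eq (p := (p.1, (p.2.1.1, p.2.1.2 + traceArray C), _)) hp, consC_eq hp]
  congr 1
  refine contr_eq_of_symmetric_part _ fun α β => ?_
  have h1 : ∀ α β, curvLin (fun μ => traceArray (D μ)) α β = D α β - D β α := fun α β => by
    rw [curvLin_apply]
    simp [traceArray, delta]
  have h2 : ∀ α β, ricci (p.1, (p.2.1.1, p.2.1.2 + traceArray C),
      p.2.2 + fun μ => (0, traceArray (D μ))) α β = ricci p α β + (D α β - D β α) := fun α β => by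
    rw [ricci_eq, ricci_eq, curvQuad_add_traceArray, ← h1]
    have : jetConn (p.2.2 + fun μ => (0, traceArray (D μ))) =
        jetConn p.2.2 + fun μ => traceArray (D μ) := rfl
    simp only [this, map_add, Pi.add_apply]
    ring
  rw [h2, h2]
  ring

/-- Trace vectors are tangent to all level sets of the constraints. -/
theorem isTangent_trace {p : JPt} (hp : p ∈ regular) (C : Fin 4 → ℝ) (D : Fin 4 → Fin 4 → ℝ) :
    IsTangent p (0, (0, traceArray C), fun μ => (0, traceArray (D μ))) := by
  have hs : ∀ t : ℝ, t • ((0, (0, traceArray C), fun μ => (0, traceArray (D μ))) : JPt) =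
      (0, (0, traceArray (t • C)), fun μ => (0, traceArray ((t • D) μ))) := fun t => by
    have h : ∀ C : Fin 4 → ℝ, t • ((0, traceArray C) : Fib) = (0, traceArray (t • C)) := fun C => by
      rw [← traceL_apply, ← traceL_apply, map_smul]
    exact Prod.ext (smul_zero t) (Prod.ext (h C) (funext fun μ => h (D μ)))
  refine constraints_forall.2 ⟨fun μ ν => ?_, fun ρ σ μ => ?_, fun α β γ => ?_,
    fun α β γ ν => ?_, fun ρ σ μ ν => ?_⟩
  · exact fderiv_apply_eq_zero_of_line fun t => by rw [hs, consC_trace hp]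
  · exact fderiv_apply_eq_zero_of_line fun t => by rw [hs, consM_trace]
  · rw [fderiv_consT, torsionDefect_traceArray]
  · refine fderiv_apply_eq_zero_of_line fun t => ?_
    rw [hs]
    change torsionDefect ((p.2.2 ν).2 + traceArray ((t • D) ν)) α β γ = _
    rw [torsionDefect_add, torsionDefect_traceArray, add_zero]
    rfl
  · exact fderiv_apply_eq_zero_of_line fun t => by rw [hs, consI_trace]

theorem isTorsionType_zero : IsTorsionType 0 :=
  ⟨fun _ _ _ => neg_zero.symm, fun _ => Finset.sum_const_zero⟩

/-! ### Natural gauge vector fields from horizontal forms -/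

theorem eDom_trans_source {M : Type*} [TopologicalSpace M]
    {e e' : OpenPartialHomeomorph M Base} {q : EPt}
    (hq : q ∈ eDom (e.symm.trans e').source) : q ∈ eDom e.target :=
  ⟨(e.symm.trans_source e' ▸ hq.1).1, hq.2⟩

section Global

variable {M : Type*} [TopologicalSpace M] [ChartedSpace Base M]

theorem HorizontalForm.contDiffAt (C : HorizontalForm M) {e : OpenPartialHomeomorph M Base}
    (he : e ∈ Charts M) {q : EPt} (hq : q ∈ eDom e.target) : ContDiffAt ℝ ∞ (C.comp e) q :=
  (C.smooth e he).contDiffAt ((isOpen_eDom e.open_target).mem_nhds hq)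

theorem EField.contDiffAt (Y : EField M) {e : OpenPartialHomeomorph M Base}
    (he : e ∈ Charts M) {q : EPt} (hq : q ∈ eDom e.target) : ContDiffAt ℝ ∞ (Y.loc e) q :=
  (Y.smooth e he).contDiffAt ((isOpen_eDom e.open_target).mem_nhds hq)

theorem liftE_mem_eDom {e e' : OpenPartialHomeomorph M Base} (he : e ∈ Charts M)
    (he' : e' ∈ Charts M) {q : EPt} (hq : q ∈ eDom (e.symm.trans e').source) :
    liftE (e.symm.trans e') q ∈ eDom e'.target := by
  have h := (isSmoothChange_of_charts he he').liftE_mem hq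
  exact ⟨(OpenPartialHomeomorph.trans_target e.symm e' ▸ h.1).1, h.2⟩

/-- The vertical vector field on `E` defined by a horizontal form. -/
def HorizontalForm.toEField (C : HorizontalForm M) : EField M where
  loc e q := (0, (0, traceArray (C.comp e q)))
  smooth e he := contDiffOn_const.prodMk (traceL.contDiff.comp_contDiffOn (C.smooth e he))
  compat e he e' he' q hq := by
    have hτ := isSmoothChange_of_charts he he'
    rw [hτ.fderiv_liftE_conn hq.1, hτ.tensorLaw_traceArray hq.1 (C.compat e he e' he' q hq)]

/-- The vector field on `J¹π` defined by a horizontal form. -/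
def HorizontalForm.toJField (C : HorizontalForm M) : JField M where
  loc e := gaugeVector (C.comp e)
  smooth e he p hp := by
    have hC : ContDiffAt ℝ ∞ (C.comp e) (toE p) := C.contDiffAt he hp
    have hE : ContDiffAt ℝ ∞ toE p := by
      unfold toE
      fun_prop
    have hD : ContDiffAt ℝ ∞ (fderiv ℝ (C.comp e)) (toE p) := hC.fderiv_right (by simp)
    refine ContDiffAt.contDiffWithinAt (contDiffAt_const.prodMk
      (ContDiffAt.prodMk (traceL.contDiff.contDiffAt.comp p (hC.comp p hE))
        (contDiffAt_pi.2 fun μ => traceL.contDiff.contDiffAt.comp p ?_)))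
    exact (ContDiffAt.comp (g := fderiv ℝ (C.comp e)) p hD hE).clm_apply
      (contDiffAt_const.prodMk (by fun_prop))
  compat e he e' he' p hp := by
    have hτ := isSmoothChange_of_charts he he'
    have hq : toE p ∈ eDom e.target := eDom_trans_source hp
    have hq' : liftE (e.symm.trans e') (toE p) ∈ eDom e'.target := liftE_mem_eDom he he' hp
    have hC := (C.contDiffAt he hq).differentiableAt (by simp)
    have hC' := (C.contDiffAt he' hq').differentiableAt (by simp)
    rw [gaugeVector_eq hC, gaugeVector_eq (p := liftJ (e.symm.trans e') p) hC']
    refine hτ.fderiv_liftJ_prolong (η := fun q => (0, traceArray (C.comp e q)))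
      (η' := fun q => (0, traceArray (C.comp e' q))) hp.1
      (traceL.differentiableAt.comp _ hC) (traceL.differentiableAt.comp _ hC') ?_
    have ho : ∀ᶠ q in nhds (toE p), q ∈ eDom (e.symm.trans e').source :=
      (isOpen_eDom (e.symm.trans e').open_source).mem_nhds hp
    filter_upwards [ho] with q hq using C.toEField.compat e he e' he' q hq

theorem HorizontalForm.isNaturalGauge_toJField (C : HorizontalForm M) :
    C.toJField.IsNaturalGauge := by
  refine ⟨⟨fun e he p hp => isTangent_trace (jDom_subset_regular _ hp.1) _ _,
    fun e he p hp => (inKernel_iff hp _ _ _).2 ⟨rfl, C.comp e (toE p), 0, isTorsionType_zero,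
      (add_zero _).symm⟩⟩, fun e he p hp => rfl, C.toEField, fun e he p hp => ?_⟩
  exact (prolong_trace ((C.contDiffAt he hp).differentiableAt (by simp))).symm

/-! ### Horizontal forms from natural gauge vector fields -/

/-- The horizontal form `-⅓ T^ν_{νβ}(f) dx^β` of a vector field on `E` with components `f` along
the connections. -/
def EField.traceForm (Y : EField M)
    (hY : ∀ e ∈ Charts M, ∀ q ∈ eDom e.target, (Y.loc e q).1 = 0) : HorizontalForm M where
  -- The factor inverts `torsionTrace_traceArray`. The formula makes sense on all of `E`, also off
  -- the locus `t = 0`, where `Y` need not be a trace field.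
  comp e q β := -1 / 3 * torsionTrace (Y.loc e q).2.2 β
  smooth e he q hq := by
    have h : ContDiffAt ℝ ∞ (fun q => (Y.loc e q).2.2) q := (Y.contDiffAt he hq).snd.snd
    have h2 : ∀ α β γ, ContDiffAt ℝ ∞ (fun q => (Y.loc e q).2.2 α β γ) q := fun α β γ =>
      contDiffAt_pi.1 (contDiffAt_pi.1 (contDiffAt_pi.1 h α) β) γ
    refine ContDiffAt.contDiffWithinAt (contDiffAt_pi.2 fun β => contDiffAt_const.mul ?_)
    exact ContDiffAt.sum fun ν _ => (h2 _ _ _).sub (h2 _ _ _)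
  compat e he e' he' q hq β := by
    have hτ := isSmoothChange_of_charts he he'
    have h := congrArg (fun a : EPt => a.2.2) (Y.compat e he e' he' q hq)
    have h0 : Y.loc e q = (0, ((Y.loc e q).2.1, (Y.loc e q).2.2)) :=
      Prod.ext (hY e he q (eDom_trans_source hq)) rfl
    rw [h0] at h
    have h1 := hτ.fderiv_liftE_snd_snd hq.1 (Y.loc e q).2.1 (Y.loc e q).2.2
    rw [← h, h1]
    simp only [mul_assoc, ← Finset.mul_sum]
    rw [hτ.sum_torsionTrace_mul_jac hq.1]

theorem traceArray_eq_of_trace (C : Fin 4 → ℝ) :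
    (fun β => -1 / 3 * torsionTrace (traceArray C) β) = C := by
  ext β
  rw [torsionTrace_traceArray]
  ring

/-- The components along the connection are known only on `t = 0`, which is not open, so their full
derivatives cannot be compared. Only derivatives along `(∂_μ, y_μ)` matter, and since `t` is linear
in `Γ`, the constraints `t` and `r` keep that whole line in the locus. -/
theorem prolong_eq_gaugeVector {Y : EPt → EPt} {C : EPt → Fin 4 → ℝ} {U : Set Base}
    (hU : IsOpen U) {p : JPt} (hp : p ∈ finalSet U)
    (hYd : DifferentiableAt ℝ Y (toE p)) (hCd : DifferentiableAt ℝ C (toE p))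
    (hY : ∀ q ∈ eDom U, (Y q).1 = 0)
    (hC : ∀ q ∈ eDom U, (∀ α β γ, torsionDefect q.2.2 α β γ = 0) →
      (Y q).2 = (0, traceArray (C q))) :
    prolong Y p = gaugeVector C p := by
  have hq : toE p ∈ eDom U := hp.1
  have ho : ∀ᶠ q in nhds (toE p), q ∈ eDom U := (isOpen_eDom hU).mem_nhds hq
  have hcons := constraints_forall.1 hp.2
  have h1 : ∀ μ, totalD (fun q => (Y q).1) μ p = 0 := fun μ => by
    have : (fun q => (Y q).1) =ᶠ[nhds (toE p)] fun _ => 0 := by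
      filter_upwards [ho] with q hq using hY q hq
    rw [totalD, this.fderiv_eq]
    simp
  have h2 : ∀ μ, totalD (fun q => (Y q).2) μ p = (0, traceArray (totalD C μ p)) := fun μ => by
    rw [← totalD_trace hCd]
    -- both functions agree along a line in the locus `t = 0`
    have hl : HasDerivAt (fun t : ℝ => toE p + t • ((bvec μ, p.2.2 μ) : EPt))
        ((bvec μ, p.2.2 μ) : EPt) 0 := by
      simpa using ((hasDerivAt_id (0 : ℝ)).smul_const ((bvec μ, p.2.2 μ) : EPt)).const_add (toE p)
    have hl0 : toE p = toE p + (0 : ℝ) • ((bvec μ, p.2.2 μ) : EPt) := by simp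
    have hf : HasFDerivAt (fun q => (Y q).2) (fderiv ℝ (fun q => (Y q).2) (toE p))
        (toE p + (0 : ℝ) • ((bvec μ, p.2.2 μ) : EPt)) := by
      rw [← hl0]
      exact hYd.snd.hasFDerivAt
    have hg : HasFDerivAt (fun q => ((0, traceArray (C q)) : Fib))
        (fderiv ℝ (fun q => ((0, traceArray (C q)) : Fib)) (toE p))
        (toE p + (0 : ℝ) • ((bvec μ, p.2.2 μ) : EPt)) := by
      rw [← hl0]
      exact (traceL.differentiableAt.comp _ hCd).hasFDerivAt
    have hf' := hf.comp_hasDerivAt (0 : ℝ) hl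
    have hg' := hg.comp_hasDerivAt (0 : ℝ) hl
    refine (hf'.congr_of_eventuallyEq ?_).unique hg'
    have hev : ∀ᶠ t : ℝ in nhds 0, toE p + t • ((bvec μ, p.2.2 μ) : EPt) ∈ eDom U := by
      have := hl.continuousAt.eventually (p := fun q => q ∈ eDom U) (by
        beta_reduce
        rwa [← hl0])
      exact this
    filter_upwards [hev] with t ht
    refine (hC _ ht fun α β γ => ?_).symm
    change torsionDefect (p.2.1.2 + t • (p.2.2 μ).2) α β γ = 0
    rw [torsionDefect_add, torsionDefect_smul]
    have h3 : torsionDefect p.2.1.2 α β γ = 0 := hcons.2.2.1 α β γ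
    have h4 : torsionDefect (p.2.2 μ).2 α β γ = 0 := hcons.2.2.2.1 α β γ μ
    rw [h3, h4, mul_zero, add_zero]
  refine Prod.ext (hY _ hq) (Prod.ext (hC _ hq hcons.2.2.1) (funext fun μ => ?_))
  change totalD (fun q => (Y q).2) μ p - ∑ ν, totalD (fun q => (Y q).1) μ p ν • p.2.2 ν = _
  rw [h2, h1]
  simp [gaugeVector]

theorem JField.IsNaturalGauge.exists_horizontalForm {X : JField M} (hX : X.IsNaturalGauge) :
    ∃ C : HorizontalForm M, ∀ e ∈ Charts M, ∀ p ∈ finalSet e.target,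
      X.loc e p = gaugeVector (C.comp e) p := by
  obtain ⟨⟨htan, hker⟩, hvert, Y, hXY⟩ := hX
  have hY : ∀ e ∈ Charts M, ∀ q ∈ eDom e.target, (Y.loc e q).1 = 0 := fun e he q hq => by
    -- The base component of a prolongation depends only on the point of `E`, so any jet over `q`
    -- will do.
    have h := hvert e he (q.1, q.2, 0) hq
    rw [hXY e he (q.1, q.2, 0) hq] at h
    exact h
  have hC : ∀ e ∈ Charts M, ∀ q ∈ eDom e.target, (∀ α β γ, torsionDefect q.2.2 α β γ = 0) →
      (Y.loc e q).2 = (0, traceArray ((Y.traceForm hY).comp e q)) := fun e he q hq ht => by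
    -- A jet of `S_f` over `q` makes the pointwise kernel and tangency results available at every
    -- point of `t = 0`.
    obtain ⟨v, hv⟩ := exists_mem_finalSet hq ht
    have hk := hker e he _ hv
    have hT := htan e he _ hv
    have hx : X.loc e (q.1, q.2, v) = (0, ((Y.loc e q).2.1, (Y.loc e q).2.2),
        (X.loc e (q.1, q.2, v)).2.2) := by
      refine Prod.ext (hvert e he _ hv.1) (Prod.ext ?_ rfl)
      rw [hXY e he _ hv.1]
      rfl
    rw [hx] at hk hT
    obtain ⟨h0, C, K, hK, hf⟩ := (inKernel_iff hv _ _ _).1 hk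
    rw [hf] at hT
    rw [hT.torsionType_eq_zero hK, add_zero] at hf
    refine Prod.ext h0 (hf.trans ?_)
    change _ = traceArray fun β => -1 / 3 * torsionTrace (Y.loc e q).2.2 β
    rw [hf, traceArray_eq_of_trace]
  refine ⟨Y.traceForm hY, fun e he p hp => ?_⟩
  rw [hXY e he p hp.1]
  exact prolong_eq_gaugeVector e.open_target hp
    ((Y.contDiffAt he hp.1).differentiableAt (by simp))
    (((Y.traceForm hY).contDiffAt he hp.1).differentiableAt (by simp)) (hY e he) (hC e he)

end Global

end

end EinsteinPalatini

theorem mainTheorem6 (M : Type*) [TopologicalSpace M] [ChartedSpace EinsteinPalatini.Base M]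
    [IsManifold 𝓘(ℝ, EinsteinPalatini.Base) ∞ M] :
    -- every natural gauge vector field has the stated local expressions on `S_f`
    (∀ X : EinsteinPalatini.JField M, X.IsNaturalGauge →
      ∃ C : EinsteinPalatini.HorizontalForm M, ∀ e ∈ EinsteinPalatini.Charts M,
        ∀ p ∈ EinsteinPalatini.finalSet e.target,
          X.loc e p = EinsteinPalatini.gaugeVector (C.comp e) p) ∧
    -- and these local expressions always define a natural gauge vector field
    (∀ C : EinsteinPalatini.HorizontalForm M, ∃ X : EinsteinPalatini.JField M,
      X.IsNaturalGauge ∧ ∀ e ∈ EinsteinPalatini.Charts M,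
        ∀ p ∈ EinsteinPalatini.jDom e.target,
          X.loc e p = EinsteinPalatini.gaugeVector (C.comp e) p) ∧
    -- at a point of `S_f`, with `u = h ∂/∂g + f ∂/∂Γ + w ∂/∂(g_{,μ}, Γ_{,μ})` vertical
    (∀ e ∈ EinsteinPalatini.Charts M, ∀ p ∈ EinsteinPalatini.finalSet e.target,
      -- the vertical solutions of `j_f^* (i(u) Ω) = 0` are the sums of a trace and a torsion one
      (∀ (h : EinsteinPalatini.Sym) (f : EinsteinPalatini.Conn)
          (w : Fin 4 → EinsteinPalatini.Fib),
        EinsteinPalatini.InKernel p (0, (h, f), w) ↔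
          h = 0 ∧ ∃ (C : Fin 4 → ℝ) (K : EinsteinPalatini.Conn),
            EinsteinPalatini.IsTorsionType K ∧ f = EinsteinPalatini.traceArray C + K) ∧
      -- and those with a non-zero torsion part are not tangent to `S_f`
      (∀ (C : Fin 4 → ℝ) (K : EinsteinPalatini.Conn) (w : Fin 4 → EinsteinPalatini.Fib),
        EinsteinPalatini.IsTorsionType K → K ≠ 0 →
          ¬ EinsteinPalatini.IsTangent p (0, (0, EinsteinPalatini.traceArray C + K), w))) := by
  refine ⟨fun X hX => hX.exists_horizontalForm,
    fun C => ⟨C.toJField, C.isNaturalGauge_toJField, fun e he p hp => rfl⟩,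
    fun e he p hp => ⟨fun h f w => EinsteinPalatini.inKernel_iff hp h f w,
      fun C K w hK hK0 ht => hK0 (ht.torsionType_eq_zero hK)⟩⟩
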